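/- **Definitions.** A *pseudogroup* $\mathcal H$ of local transformations of a topological space $Z$ is a collection of homeomorphisms between open subsets of $Z$ that contains $\mathrm{id}_Z$ and is closed under composition (wherever defined), inversion, restriction to open sets and combination. It is *generated* by $E\subset\mathcal H$ if it is the smallest pseudogroup containing $E$; $E$ is *symmetric* if $h\in E$ implies $h^{-1}\in E$. * Let $Z$ be locally compact. $\mathcal H$ is *compactly generated* if there is a relatively compact open set $U\subset Z$ meeting every $\mathcal H$-orbit such that the restriction $\mathcal G$ of $\mathcal H$ to $U$ (the maps of $\mathcal H$ between open subsets of $U$) is generated, as a pseudogroup on $U$, by a finite symmetric set $E\subset\mathcal G$, each of whose elements $g$ is the restriction of some $\bar g\in\mathcal H$ defined on a neighborhood of the closure in $Z$ of $\operatorname{dom} g$. * $\mathcal H$ is *quasi-effective* if it is generated by a symmetric set $S$, closed under compositions, such that every $h\in S$ that is the identity on some non-empty open subset of its domain is the identity on its whole domain. * A *cover of $Z$ by quasi-locally equal metric spaces* is a family of metric spaces $\{(Z_i,d_i)\}_{i\in I}$ with $Z=\bigcup_i Z_i$, each $Z_i\cap Z_j$ open in $(Z_i,d_i)$ and in $(Z_j,d_j)$,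 for which there is an assignment $\epsilon\mapsto\delta(\epsilon)>0$ $(\epsilon>0)$ such that for all $i,j\in I$ and $z\in Z_i\cap Z_j$ there is a neighborhood $U_{i,j,z}$ of $z$ in $Z_i\cap Z_j$, open for $d_i$ and for $d_j$, with $$d_i(x,y)<\delta(\epsilon)\Longrightarrow d_j(x,y)<\epsilon\qquad\text{for all }\epsilon>0\text{ and all }x,y\in U_{i,j,z}.$$ It is a *cover by locally equal metric spaces* if instead of the last condition $d_i$ and $d_j$ induce the same topology on $Z_i\cap Z_j$ and each point of $Z_i\cap Z_j$ has a neighborhood there on which $d_i=d_j$, for all $i,j$. Two covers of one of these kinds are equivalent if their union is again a cover of that kind; a *quasi-local metric* (respectively, *local metric*) on $Z$ is an equivalence class of covers of the first (respectively, second) kind. It *induces the topology of $Z$* if the open balls of the members of its covers form a base of that topology. * $\mathcal H$ is *strongly equicontinuous* if there are a quasi-local metric $\mathfrak Q$ inducing the topology of $Z$, a cover $\{(Z_i,d_i)\}_{i\in I}\in\mathfrak Q$ and a symmetric set $S$ of generators of $\mathcal H$, closed under compositions, such that for every $\epsilon>0$ there is $\delta(\epsilon)>0$ with $$d_i(x,y)<\delta(\epsilon)\Longrightarrow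 d_j(h(x),h(y))<\epsilon$$ for all $h\in S$, all $i,j\in I$ and all $x,y\in Z_i\cap h^{-1}(Z_j\cap\operatorname{im}h)$. * Let $\mathfrak D$ be a local metric inducing the topology of $Z$. A homeomorphism $h$ between open subsets of $Z$ is a *local isometry* of $(Z,\mathfrak D)$ if there is $\{(Z_i,d_i)\}_{i\in I}\in\mathfrak D$ such that for all $i,j\in I$ every $z\in Z_i\cap h^{-1}(Z_j\cap\operatorname{im}h)$ has a neighborhood in $Z_i\cap h^{-1}(Z_j\cap\operatorname{im}h)$ on which $d_i(x,y)=d_j(h(x),h(y))$ for all $x,y$. **Theorem.** Let $\mathcal H$ be a compactly generated, quasi-effective and strongly equicontinuous pseudogroup of local transformations of a locally compact Polish space $Z$. Then there is a local metric $\mathfrak D$ on $Z$ inducing the topology of $Z$ such that every $h\in\mathcal H$ is a local isometry of $(Z,\mathfrak D)$. -/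

import Mathlib

open Set Topology TopologicalSpace

universe u

namespace PseudoGrp

/-! ### Pseudogroups, generators, orbits

A pseudogroup of local transformations of `Z` is a `StructureGroupoid Z` that is
`ClosedUnderRestriction`: a set of homeomorphisms between open subsets of `Z` containing the
identity, closed under composition, inversion, restriction to open sets and combination
(`locality`), where two open partial homeomorphisms are identified when they have the same source
and agree on it. -/

section Pseudogroups

variable {Z : Type u} [TopologicalSpace Z]

/-- `G` is a pseudogroup of local transformations of the open subspace `U` of `Z`; a homeomorphism
between open subsets of `U` is represented by an open partial homeomorphism of `Z` whose source and
target are contained in `U`. -/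
structure IsPseudogroupOn (U : Opens Z) (G : Set (OpenPartialHomeomorph Z Z)) : Prop where
  source_subset : ∀ g ∈ G, g.source ⊆ U
  target_subset : ∀ g ∈ G, g.target ⊆ U
  id_mem : OpenPartialHomeomorph.ofSet (U : Set Z) U.isOpen ∈ G
  comp_mem : ∀ g ∈ G, ∀ g' ∈ G, g.trans g' ∈ G
  symm_mem : ∀ g ∈ G, g.symm ∈ G
  restr_mem : ∀ g ∈ G, ∀ s : Set Z, IsOpen s → g.restr s ∈ G
  combination_mem : ∀ g : OpenPartialHomeomorph Z Z, g.source ⊆ U → g.target ⊆ U →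
    (∀ x ∈ g.source, ∃ s : Set Z, IsOpen s ∧ x ∈ s ∧ g.restr s ∈ G) → g ∈ G
  mem_of_eqOnSource : ∀ g ∈ G, ∀ g' : OpenPartialHomeomorph Z Z, g' ≈ g → g' ∈ G

/-- The restriction of the pseudogroup `H` to the open subset `U`: all maps of `H` between open
subsets of `U`. -/
def restrictTo (H : StructureGroupoid Z) (U : Opens Z) : Set (OpenPartialHomeomorph Z Z) :=
  {h | h ∈ H ∧ h.source ⊆ U ∧ h.target ⊆ U}

/-- The restriction of a pseudogroup to an open set is a pseudogroup on that open set. -/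
theorem isPseudogroupOn_restrictTo (H : StructureGroupoid Z) [ClosedUnderRestriction H]
    (U : Opens Z) : IsPseudogroupOn U (restrictTo H U) where
  source_subset _ hg := hg.2.1
  target_subset _ hg := hg.2.2
  id_mem := by
    refine ⟨?_, subset_rfl, subset_rfl⟩
    exact (closedUnderRestriction_iff_id_le H).1 inferInstance (idRestrGroupoid_mem U.isOpen)
  comp_mem g hg g' hg' := by
    refine ⟨H.trans hg.1 hg'.1, fun x hx => hg.2.1 ?_, fun x hx => hg'.2.2 ?_⟩
    · rw [OpenPartialHomeomorph.trans_source] at hx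
      exact hx.1
    · rw [OpenPartialHomeomorph.trans_target] at hx
      exact hx.1
  symm_mem _ hg := ⟨H.symm hg.1, hg.2.2, hg.2.1⟩
  restr_mem g hg s hs := by
    refine ⟨closedUnderRestriction' hg.1 hs, fun x hx => hg.2.1 ?_, fun x hx => hg.2.2 ?_⟩
    · rw [OpenPartialHomeomorph.restr_source] at hx
      exact hx.1
    · rw [OpenPartialHomeomorph.restr_target] at hx
      exact hx.1
  combination_mem g hs ht hloc :=
    ⟨H.locality fun x hx => let ⟨s, h1, h2, h3⟩ := hloc x hx; ⟨s, h1, h2, h3.1⟩, hs, ht⟩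
  mem_of_eqOnSource g hg g' hgg' := by
    refine ⟨H.mem_of_eqOnSource hg.1 hgg', ?_, ?_⟩
    · rw [OpenPartialHomeomorph.EqOnSource.source_eq hgg']; exact hg.2.1
    · rw [OpenPartialHomeomorph.EqOnSource.target_eq hgg']; exact hg.2.2

/-- The pseudogroup `G` on the open set `U` is generated by `E ⊆ G`: it is the smallest pseudogroup
on `U` that contains `E`. -/
def IsGeneratedOn (U : Opens Z) (G E : Set (OpenPartialHomeomorph Z Z)) : Prop :=
  E ⊆ G ∧ ∀ G' : Set (OpenPartialHomeomorph Z Z), IsPseudogroupOn U G' → E ⊆ G' → G ⊆ G'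

/-- The pseudogroup `H` on `Z` is generated by `S`. -/
def IsGeneratedBy (H : StructureGroupoid Z) (S : Set (OpenPartialHomeomorph Z Z)) : Prop :=
  IsGeneratedOn ⊤ (restrictTo H ⊤) S

/-- A set of local transformations is symmetric if it is closed under inversion. -/
def IsSymmetric (S : Set (OpenPartialHomeomorph Z Z)) : Prop :=
  ∀ h ∈ S, h.symm ∈ S

/-- Closure under composition (composites have their maximal domain, which may be empty). -/
def IsClosedUnderComp (S : Set (OpenPartialHomeomorph Z Z)) : Prop :=
  ∀ h ∈ S, ∀ h' ∈ S, h.trans h' ∈ S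

/-- The set `U` meets every orbit of `H`. -/
def MeetsEveryOrbit (H : StructureGroupoid Z) (U : Set Z) : Prop :=
  ∀ x : Z, ∃ h ∈ H, x ∈ h.source ∧ h x ∈ U

/-- Compactly generated pseudogroups (Haefliger). -/
def IsCompactlyGenerated (H : StructureGroupoid Z) : Prop :=
  ∃ U : Opens Z, IsCompact (closure (U : Set Z)) ∧ MeetsEveryOrbit H U ∧
    ∃ E : Set (OpenPartialHomeomorph Z Z), E.Finite ∧ IsSymmetric E ∧
      IsGeneratedOn U (restrictTo H U) E ∧
      ∀ g ∈ E, ∃ gbar ∈ H, closure g.source ⊆ gbar.source ∧ EqOn gbar g g.source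

/-- Quasi-effective pseudogroups. -/
def IsQuasiEffective (H : StructureGroupoid Z) : Prop :=
  ∃ S : Set (OpenPartialHomeomorph Z Z), IsSymmetric S ∧ IsClosedUnderComp S ∧
    IsGeneratedBy H S ∧
    ∀ h ∈ S, (∃ O : Set Z, IsOpen O ∧ O.Nonempty ∧ O ⊆ h.source ∧ EqOn h id O) →
      EqOn h id h.source

end Pseudogroups

/-! ### Families of metric spaces covering a set -/

/-- A metric space `(Z_i, d_i)` whose underlying set `Z_i` is a subset of `Z`. -/
structure MetricPiece (Z : Type u) where
  carrier : Set Z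
  metric : MetricSpace carrier

namespace MetricPiece

variable {Z : Type u}

/-- The distance of a metric piece. -/
def dist (P : MetricPiece Z) (x y : P.carrier) : ℝ :=
  P.metric.dist x y

/-- The topology defined by the metric of a piece. -/
abbrev topology (P : MetricPiece Z) : TopologicalSpace P.carrier :=
  P.metric.toPseudoMetricSpace.toUniformSpace.toTopologicalSpace

/-- `A ⊆ P.carrier` is open in the metric space `P`. -/
def IsOpenIn (P : MetricPiece Z) (A : Set Z) : Prop :=
  A ⊆ P.carrier ∧ IsOpen[P.topology] ((Subtype.val : P.carrier → Z) ⁻¹' A)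

/-- The restriction of the metric of `P` to a subset `A` of `P.carrier`. -/
abbrev restrict (P : MetricPiece Z) (A : Set Z) (hA : A ⊆ P.carrier) : MetricSpace A :=
  MetricSpace.induced (Set.inclusion hA) (Set.inclusion_injective hA) P.metric

/-- The open ball in `P` with center `x` and radius `r`, as a subset of `Z`. -/
def ball (P : MetricPiece Z) (x : P.carrier) (r : ℝ) : Set Z :=
  Subtype.val '' {y : P.carrier | P.dist y x < r}

end MetricPiece

section LocalMetrics

variable {Z : Type u}

/-- The family of metric spaces `C` covers `Z`, and every intersection of two members is open in
both of them. -/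
def IsMetricCover (C : Set (MetricPiece Z)) : Prop :=
  (∀ z : Z, ∃ P ∈ C, z ∈ P.carrier) ∧
    ∀ P ∈ C, ∀ Q ∈ C,
      P.IsOpenIn (P.carrier ∩ Q.carrier) ∧ Q.IsOpenIn (P.carrier ∩ Q.carrier)

/-- Covers of `Z` by quasi-locally equal metric spaces. The assignment `ε ↦ δ ε` is the same for
all members of the family and all points, and the neighborhood `U` does not depend on `ε`. -/
def IsQuasiLocalCover (C : Set (MetricPiece Z)) : Prop :=
  IsMetricCover C ∧
    ∃ δ : ℝ → ℝ, (∀ ε > 0, 0 < δ ε) ∧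
      ∀ P ∈ C, ∀ Q ∈ C, ∀ z ∈ P.carrier ∩ Q.carrier,
        ∃ U : Set Z, z ∈ U ∧ P.IsOpenIn U ∧ Q.IsOpenIn U ∧
          ∀ ε > 0, ∀ x ∈ U, ∀ y ∈ U,
            ∀ (hxP : x ∈ P.carrier) (hyP : y ∈ P.carrier)
              (hxQ : x ∈ Q.carrier) (hyQ : y ∈ Q.carrier),
              P.dist ⟨x, hxP⟩ ⟨y, hyP⟩ < δ ε → Q.dist ⟨x, hxQ⟩ ⟨y, hyQ⟩ < ε

/-- A quasi-local metric on `Z`: the class of all covers by quasi-locally equal metric spaces that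
are quasi-locally equal to a given one, i.e. whose union with it is again such a cover. -/
def IsQuasiLocalMetric (Q : Set (Set (MetricPiece Z))) : Prop :=
  ∃ C, IsQuasiLocalCover C ∧ Q = {C' | IsQuasiLocalCover C' ∧ IsQuasiLocalCover (C ∪ C')}

/-- Two metrics on the same set are locally equal: they induce the same topology, and each point
has a neighborhood where they are equal. -/
def MetricsLocallyEqual {X : Type u} (m m' : MetricSpace X) : Prop :=
  m.toPseudoMetricSpace.toUniformSpace.toTopologicalSpace =
      m'.toPseudoMetricSpace.toUniformSpace.toTopologicalSpace ∧
    ∀ z : X, ∃ U : Set X,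
      IsOpen[m.toPseudoMetricSpace.toUniformSpace.toTopologicalSpace] U ∧ z ∈ U ∧
        ∀ x ∈ U, ∀ y ∈ U, m.dist x y = m'.dist x y

/-- Covers of `Z` by locally equal metric spaces. -/
def IsLocalCover (C : Set (MetricPiece Z)) : Prop :=
  IsMetricCover C ∧
    ∀ P ∈ C, ∀ Q ∈ C,
      MetricsLocallyEqual (P.restrict (P.carrier ∩ Q.carrier) inter_subset_left)
        (Q.restrict (P.carrier ∩ Q.carrier) inter_subset_right)

/-- A local metric on `Z`: the class of all covers by locally equal metric spaces that are locally
equal to a given one, i.e. whose union with it is again such a cover. -/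
def IsLocalMetric (D : Set (Set (MetricPiece Z))) : Prop :=
  ∃ C, IsLocalCover C ∧ D = {C' | IsLocalCover C' ∧ IsLocalCover (C ∪ C')}

/-- The open balls of the members of a family of metric spaces. -/
def balls (C : Set (MetricPiece Z)) : Set (Set Z) :=
  {B | ∃ P ∈ C, ∃ x : P.carrier, ∃ r : ℝ, 0 < r ∧ B = P.ball x r}

/-- A (quasi-)local metric induces the topology of `Z`: for every family in the class, the open
balls of its members form a base of the topology. -/
def InducesTopology [TopologicalSpace Z] (Q : Set (Set (MetricPiece Z))) : Prop :=
  ∀ C ∈ Q, IsTopologicalBasis (balls C)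

end LocalMetrics

/-! ### Strong equicontinuity and local isometries -/

section Equicontinuity

variable {Z : Type u} [TopologicalSpace Z]

/-- `H` is strongly equicontinuous with respect to the quasi-local metric `Q`. -/
def IsStronglyEquicontinuousWrt (H : StructureGroupoid Z) (Q : Set (Set (MetricPiece Z))) : Prop :=
  ∃ C ∈ Q, ∃ S : Set (OpenPartialHomeomorph Z Z),
    IsSymmetric S ∧ IsClosedUnderComp S ∧ IsGeneratedBy H S ∧
      ∀ ε > 0, ∃ δ > 0, ∀ h ∈ S, ∀ P ∈ C, ∀ R ∈ C,
        ∀ x ∈ h.source, ∀ y ∈ h.source,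
          ∀ (hx : x ∈ P.carrier) (hy : y ∈ P.carrier)
            (hhx : h x ∈ R.carrier) (hhy : h y ∈ R.carrier),
            P.dist ⟨x, hx⟩ ⟨y, hy⟩ < δ → R.dist ⟨h x, hhx⟩ ⟨h y, hhy⟩ < ε

/-- `H` is strongly equicontinuous: it is so with respect to some quasi-local metric inducing the
topology of `Z`. -/
def IsStronglyEquicontinuous (H : StructureGroupoid Z) : Prop :=
  ∃ Q : Set (Set (MetricPiece Z)),
    IsQuasiLocalMetric Q ∧ InducesTopology Q ∧ IsStronglyEquicontinuousWrt H Q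

/-- The homeomorphism `h` between open subsets of `Z` is a local isometry of the local metric
space `(Z, D)`. -/
def IsLocalIsometry (D : Set (Set (MetricPiece Z))) (h : OpenPartialHomeomorph Z Z) : Prop :=
  ∃ C ∈ D, ∀ P ∈ C, ∀ R ∈ C, ∀ z ∈ h.source, z ∈ P.carrier → h z ∈ R.carrier →
    ∃ U ∈ 𝓝 z, U ⊆ h.source ∧ U ⊆ P.carrier ∧ MapsTo h U R.carrier ∧
      ∀ x ∈ U, ∀ y ∈ U,
        ∀ (hx : x ∈ P.carrier) (hy : y ∈ P.carrier)
          (hhx : h x ∈ R.carrier) (hhy : h y ∈ R.carrier),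
          P.dist ⟨x, hx⟩ ⟨y, hy⟩ = R.dist ⟨h x, hhx⟩ ⟨h y, hhy⟩

end Equicontinuity

end PseudoGrp

/-! Let `T` consist of the restrictions common to a quasi-effective and a strongly equicontinuous
generating set; every map of `H` is locally in `T`. A germ of `T` between points of the relatively
compact set `U` is the germ of a word in finitely many generators. Each generator extends past the
closure of its domain, and equicontinuity keeps the images of one small ball inside these extensions
however long the word is. Hence all these germs extend, within `T`, to balls of one radius `δ₀`
(`exists_isUniformlyExtendable`). By quasi-effectiveness an element of `T` also agrees with such an
extension at any second point whose image is close enough (`exists_extension_eq`).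

The invariant distance `supDist` is the supremum, over `m ∈ T`, of the distance between the images
under `m`. Only pairs of images closer than `ε₁` count, and the complement of `U` is collapsed
(`cutDist`). Invariance is formal, since `T` is closed under composition and inversion.
Equicontinuity of the extensions gives continuity and the triangle inequality near each point of `U`
(`exists_invariant_dist`). Since `U` meets every orbit, maps of `H` carry these metrics to all of
`Z`; being restrictions of a single function, they are locally equal and `H` acts by local
isometries (`exists_isLocalMetric_of_invariant`). -/

namespace PseudoGrp

/-! ### Germs of a pseudogroup in terms of generators -/

section Generation

variable {Z : Type u} [TopologicalSpace Z]

/-- A set of local transformations that contains the identity and is closed under composition,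
inversion and restriction. -/
structure IsRestrictionClosed (T : Set (OpenPartialHomeomorph Z Z)) : Prop where
  refl_mem : OpenPartialHomeomorph.refl Z ∈ T
  sub_mem : ∀ h ∈ T, ∀ h' : OpenPartialHomeomorph Z Z,
    h'.source ⊆ h.source → EqOn h' h h'.source → h' ∈ T
  comp_mem : ∀ h ∈ T, ∀ h' ∈ T, h.trans h' ∈ T
  symm_mem : ∀ h ∈ T, h.symm ∈ T

/-- The restrictions of the elements of `S` and of the identity. -/
def restrictions (S : Set (OpenPartialHomeomorph Z Z)) : Set (OpenPartialHomeomorph Z Z) :=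
  {h | ∃ s, (s ∈ S ∨ s = OpenPartialHomeomorph.refl Z) ∧ h.source ⊆ s.source ∧
    EqOn h s h.source}

theorem subset_restrictions (S : Set (OpenPartialHomeomorph Z Z)) : S ⊆ restrictions S :=
  fun s hs => ⟨s, Or.inl hs, subset_rfl, fun _ _ => rfl⟩

theorem isRestrictionClosed_restrictions {S : Set (OpenPartialHomeomorph Z Z)}
    (hsymm : IsSymmetric S) (hcomp : IsClosedUnderComp S) :
    IsRestrictionClosed (restrictions S) where
  refl_mem := ⟨_, Or.inr rfl, subset_rfl, fun _ _ => rfl⟩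
  sub_mem := by
    rintro h ⟨s, hs, h1, h2⟩ h' h3 h4
    exact ⟨s, hs, h3.trans h1, fun x hx => (h4 hx).trans (h2 (h3 hx))⟩
  comp_mem := by
    rintro h ⟨s, hs, h1, h2⟩ h' ⟨s', hs', h1', h2'⟩
    refine ⟨s.trans s', ?_, ?_, ?_⟩
    · rcases hs with hs | rfl
      · rcases hs' with hs' | rfl
        · exact Or.inl (hcomp s hs s' hs')
        · left; simpa using hs
      · simpa using hs'
    · intro x hx
      simp only [OpenPartialHomeomorph.trans_source, mem_inter_iff, mem_preimage] at hx ⊢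
      refine ⟨h1 hx.1, ?_⟩
      rw [← h2 hx.1]; exact h1' hx.2
    · intro x hx
      simp only [OpenPartialHomeomorph.trans_source, mem_inter_iff, mem_preimage] at hx
      simp only [OpenPartialHomeomorph.coe_trans, Function.comp_apply]
      rw [h2' hx.2, h2 hx.1]
  symm_mem := by
    rintro h ⟨s, hs, h1, h2⟩
    refine ⟨s.symm, ?_, ?_, ?_⟩
    · rcases hs with hs | rfl
      · exact Or.inl (hsymm s hs)
      · right; simp
    · intro y hy
      simp only [OpenPartialHomeomorph.symm_source] at hy ⊢
      have hx := h.map_target hy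
      rw [← h.right_inv hy, h2 hx]
      exact s.map_source (h1 hx)
    · intro y hy
      simp only [OpenPartialHomeomorph.symm_source] at hy
      have hx := h.map_target hy
      have : s (h.symm y) = y := by rw [← h2 hx, h.right_inv hy]
      nth_rewrite 2 [← this]
      rw [s.left_inv (h1 hx)]

theorem IsRestrictionClosed.inter {T T' : Set (OpenPartialHomeomorph Z Z)}
    (hT : IsRestrictionClosed T) (hT' : IsRestrictionClosed T') :
    IsRestrictionClosed (T ∩ T') where
  refl_mem := ⟨hT.refl_mem, hT'.refl_mem⟩
  sub_mem h hh h' h1 h2 := ⟨hT.sub_mem h hh.1 h' h1 h2, hT'.sub_mem h hh.2 h' h1 h2⟩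
  comp_mem h hh h' hh' := ⟨hT.comp_mem h hh.1 h' hh'.1, hT'.comp_mem h hh.2 h' hh'.2⟩
  symm_mem h hh := ⟨hT.symm_mem h hh.1, hT'.symm_mem h hh.2⟩

theorem IsRestrictionClosed.restr_mem {T : Set (OpenPartialHomeomorph Z Z)}
    (hT : IsRestrictionClosed T) {h : OpenPartialHomeomorph Z Z} (hh : h ∈ T) (s : Set Z) :
    h.restr s ∈ T :=
  hT.sub_mem h hh _ (by rw [OpenPartialHomeomorph.restr_source]; exact inter_subset_left)
    (fun _ _ => rfl)

/-- The local transformations of `U` that locally belong to `T`. -/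
def localization (U : Opens Z) (T : Set (OpenPartialHomeomorph Z Z)) :
    Set (OpenPartialHomeomorph Z Z) :=
  {h | h.source ⊆ U ∧ h.target ⊆ U ∧ ∀ x ∈ h.source, ∃ s, IsOpen s ∧ x ∈ s ∧ h.restr s ∈ T}

/-- Generation is defined by minimality, so germs of generated maps are described by exhibiting a
competing pseudogroup. Localizing supplies the closure under combination that `T` itself may lack.
-/
theorem isPseudogroupOn_localization (U : Opens Z) {T : Set (OpenPartialHomeomorph Z Z)}
    (hT : IsRestrictionClosed T) : IsPseudogroupOn U (localization U T) where
  source_subset _ hg := hg.1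
  target_subset _ hg := hg.2.1
  id_mem := by
    refine ⟨subset_rfl, subset_rfl, fun x _ => ⟨univ, isOpen_univ, mem_univ _, ?_⟩⟩
    exact hT.sub_mem _ hT.refl_mem _ (by simp) (fun x _ => rfl)
  comp_mem := by
    rintro g ⟨h1, h2, h3⟩ g' ⟨h1', h2', h3'⟩
    refine ⟨?_, ?_, ?_⟩
    · exact fun x hx => h1 (by rw [OpenPartialHomeomorph.trans_source] at hx; exact hx.1)
    · exact fun x hx => h2' (by rw [OpenPartialHomeomorph.trans_target] at hx; exact hx.1)
    · intro x hx
      rw [OpenPartialHomeomorph.trans_source] at hx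
      obtain ⟨s, hs, hxs, hgs⟩ := h3 x hx.1
      obtain ⟨s', hs', hxs', hgs'⟩ := h3' (g x) hx.2
      refine ⟨g.source ∩ g ⁻¹' s' ∩ s, (g.isOpen_inter_preimage hs').inter hs,
        ⟨⟨hx.1, hxs'⟩, hxs⟩, ?_⟩
      refine hT.sub_mem _ (hT.comp_mem _ hgs _ hgs') _ ?_ (fun y _ => rfl)
      intro y hy
      simp only [OpenPartialHomeomorph.restr_source, OpenPartialHomeomorph.trans_source,
        mem_inter_iff, mem_preimage, hs.interior_eq, hs'.interior_eq,
        ((g.isOpen_inter_preimage hs').inter hs).interior_eq] at hy ⊢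
      exact ⟨⟨hy.1.1, hy.2.2⟩, hy.1.2, hy.2.1.2⟩
  symm_mem := by
    rintro g ⟨h1, h2, h3⟩
    refine ⟨h2, h1, fun y hy => ?_⟩
    have hx := g.map_target hy
    obtain ⟨s, hs, hxs, hgs⟩ := h3 _ hx
    have ho := g.symm.isOpen_inter_preimage hs
    refine ⟨_, ho, ⟨hy, hxs⟩, ?_⟩
    refine hT.sub_mem _ (hT.symm_mem _ hgs) _ ?_ (fun y _ => rfl)
    intro z hz
    rw [OpenPartialHomeomorph.restr_source, ho.interior_eq] at hz
    have hz1 : z ∈ g.target := hz.1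
    have hz2 : g.symm z ∈ s := hz.2.2
    have : g.symm z ∈ (g.restr s).source := by
      rw [OpenPartialHomeomorph.restr_source, hs.interior_eq]
      exact ⟨g.map_target hz1, hz2⟩
    have h4 := (g.restr s).map_source this
    have h5 : (g.restr s) (g.symm z) = z := g.right_inv hz1
    rw [h5] at h4
    exact h4
  restr_mem := by
    rintro g ⟨h1, h2, h3⟩ t ht
    refine ⟨?_, ?_, ?_⟩
    · exact fun x hx => h1 (by rw [OpenPartialHomeomorph.restr_source] at hx; exact hx.1)
    · exact fun x hx => h2 (by rw [OpenPartialHomeomorph.restr_target] at hx; exact hx.1)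
    · intro x hx
      rw [OpenPartialHomeomorph.restr_source] at hx
      obtain ⟨s, hs, hxs, hgs⟩ := h3 x hx.1
      refine ⟨s, hs, hxs, hT.sub_mem _ hgs _ ?_ (fun y _ => rfl)⟩
      intro y hy
      simp only [OpenPartialHomeomorph.restr_source, mem_inter_iff] at hy ⊢
      exact ⟨hy.1.1, hy.2⟩
  combination_mem := by
    intro g h1 h2 h3
    refine ⟨h1, h2, fun x hx => ?_⟩
    obtain ⟨s, hs, hxs, -, -, hgs⟩ := h3 x hx
    obtain ⟨t, ht, hxt, hgt⟩ := hgs x (by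
      rw [OpenPartialHomeomorph.restr_source, hs.interior_eq]; exact ⟨hx, hxs⟩)
    refine ⟨s ∩ t, hs.inter ht, ⟨hxs, hxt⟩, hT.sub_mem _ hgt _ ?_ (fun y _ => rfl)⟩
    intro y hy
    simp only [OpenPartialHomeomorph.restr_source, mem_inter_iff, hs.interior_eq, ht.interior_eq,
      (hs.inter ht).interior_eq] at hy ⊢
    tauto
  mem_of_eqOnSource := by
    rintro g ⟨h1, h2, h3⟩ g' hgg'
    refine ⟨?_, ?_, ?_⟩
    · rw [OpenPartialHomeomorph.EqOnSource.source_eq hgg']; exact h1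
    · rw [OpenPartialHomeomorph.EqOnSource.target_eq hgg']; exact h2
    · intro x hx
      rw [OpenPartialHomeomorph.EqOnSource.source_eq hgg'] at hx
      obtain ⟨s, hs, hxs, hgs⟩ := h3 x hx
      refine ⟨s, hs, hxs, hT.sub_mem _ hgs _ ?_ ?_⟩
      · intro y hy
        simp only [OpenPartialHomeomorph.restr_source, mem_inter_iff] at hy ⊢
        rw [OpenPartialHomeomorph.EqOnSource.source_eq hgg'] at hy
        exact hy
      · intro y hy
        rw [OpenPartialHomeomorph.restr_source] at hy
        exact hgg'.2 hy.1

theorem IsGeneratedOn.subset_localization {U : Opens Z} {G E T : Set (OpenPartialHomeomorph Z Z)}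
    (hgen : IsGeneratedOn U G E) (hGU : ∀ g ∈ G, g.source ⊆ U ∧ g.target ⊆ U)
    (hT : IsRestrictionClosed T) (hET : E ⊆ T) : G ⊆ localization U T := by
  refine hgen.2 _ (isPseudogroupOn_localization U hT) fun g hg => ?_
  refine ⟨(hGU g (hgen.1 hg)).1, (hGU g (hgen.1 hg)).2, fun x _ => ?_⟩
  exact ⟨univ, isOpen_univ, mem_univ _, hT.restr_mem (hET hg) _⟩

theorem IsGeneratedBy.exists_restr_mem {H : StructureGroupoid Z}
    {S T : Set (OpenPartialHomeomorph Z Z)} (hgen : IsGeneratedBy H S)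
    (hT : IsRestrictionClosed T) (hST : S ⊆ T) {h : OpenPartialHomeomorph Z Z} (hh : h ∈ H)
    {x : Z} (hx : x ∈ h.source) : ∃ s, IsOpen s ∧ x ∈ s ∧ h.restr s ∈ T :=
  (IsGeneratedOn.subset_localization hgen (fun _ hg => hg.2) hT hST
    ⟨hh, fun _ _ => trivial, fun _ _ => trivial⟩).2.2 x hx

/-- Finite compositions of elements of `E`. -/
inductive IsWord (E : Set (OpenPartialHomeomorph Z Z)) : OpenPartialHomeomorph Z Z → Prop
  | refl : IsWord E (OpenPartialHomeomorph.refl Z)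
  | trans {w g : OpenPartialHomeomorph Z Z} : IsWord E w → g ∈ E → IsWord E (w.trans g)

theorem IsWord.comp {E : Set (OpenPartialHomeomorph Z Z)} {w w' : OpenPartialHomeomorph Z Z}
    (hw : IsWord E w) (hw' : IsWord E w') : IsWord E (w.trans w') := by
  induction hw' with
  | refl => simpa using hw
  | trans _ hg ih => rw [← OpenPartialHomeomorph.trans_assoc]; exact ih.trans hg

theorem IsWord.of_mem {E : Set (OpenPartialHomeomorph Z Z)} {g : OpenPartialHomeomorph Z Z}
    (hg : g ∈ E) : IsWord E g := by
  simpa using IsWord.refl.trans hg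

theorem IsWord.symm {E : Set (OpenPartialHomeomorph Z Z)} (hE : IsSymmetric E)
    {w : OpenPartialHomeomorph Z Z} (hw : IsWord E w) : IsWord E w.symm := by
  induction hw with
  | refl => simpa using IsWord.refl
  | trans _ hg ih =>
    rw [OpenPartialHomeomorph.trans_symm_eq_symm_trans_symm]
    exact (IsWord.of_mem (hE _ hg)).comp ih

/-- Every germ of a pseudogroup is the germ of a word in the generators. -/
theorem IsGeneratedOn.exists_isWord {U : Opens Z} {G E : Set (OpenPartialHomeomorph Z Z)}
    (hgen : IsGeneratedOn U G E) (hGU : ∀ g ∈ G, g.source ⊆ U ∧ g.target ⊆ U)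
    (hE : IsSymmetric E) {g : OpenPartialHomeomorph Z Z} (hg : g ∈ G) {x : Z}
    (hx : x ∈ g.source) : ∃ w, IsWord E w ∧ x ∈ w.source ∧ w =ᶠ[𝓝 x] g := by
  have hT : IsRestrictionClosed (restrictions {w | IsWord E w}) :=
    isRestrictionClosed_restrictions (fun w hw => IsWord.symm hE hw)
      (fun w hw w' hw' => IsWord.comp hw hw')
  obtain ⟨s, hs, hxs, w, hw, h1, h2⟩ := (hgen.subset_localization hGU hT
    (fun g hg => subset_restrictions _ (IsWord.of_mem hg)) hg).2.2 x hx
  rw [OpenPartialHomeomorph.restr_source, hs.interior_eq] at h1 h2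
  -- `restrictions` adjoins the identity, which is the empty word.
  refine ⟨w, ?_, h1 ⟨hx, hxs⟩, ?_⟩
  · rcases hw with hw | rfl
    · exact hw
    · exact IsWord.refl
  · filter_upwards [(g.open_source.inter hs).mem_nhds ⟨hx, hxs⟩] with y hy
    exact (h2 hy).symm

end Generation

/-! ### Elementary facts on the distance of a metric piece -/

section PieceDist

variable {Z : Type u}

theorem MetricPiece.dist_self' (P : MetricPiece Z) (x : P.carrier) : P.dist x x = 0 :=
  @_root_.dist_self _ P.metric.toPseudoMetricSpace x

theorem MetricPiece.dist_comm' (P : MetricPiece Z) (x y : P.carrier) : P.dist x y = P.dist y x :=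
  @_root_.dist_comm _ P.metric.toPseudoMetricSpace x y

theorem MetricPiece.dist_triangle' (P : MetricPiece Z) (x y z : P.carrier) :
    P.dist x z ≤ P.dist x y + P.dist y z :=
  @_root_.dist_triangle _ P.metric.toPseudoMetricSpace x y z

theorem MetricPiece.exists_dist_lt_of_isOpenIn {P : MetricPiece Z} {A : Set Z}
    (hA : P.IsOpenIn A) {z : P.carrier} (hz : (z : Z) ∈ A) :
    ∃ s > 0, ∀ y : P.carrier, P.dist z y < s → (y : Z) ∈ A := by
  obtain ⟨s, hs, h⟩ := (@Metric.isOpen_iff _ P.metric.toPseudoMetricSpace _).1 hA.2 z hz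
  refine ⟨s, hs, fun y hy => h ?_⟩
  rw [P.dist_comm'] at hy
  exact hy

end PieceDist

/-! ### Comparison of a quasi-local metric with a global metric -/

section QuasiLocalMetric

variable {Z : Type u} [MetricSpace Z] {C : Set (MetricPiece Z)}

theorem exists_ball_subset_ball (hC : IsTopologicalBasis (balls C)) {P : MetricPiece Z}
    (hP : P ∈ C) (z : P.carrier) {δ : ℝ} (hδ : 0 < δ) :
    ∃ r > 0, Metric.ball (z : Z) r ⊆ P.ball z δ :=
  Metric.isOpen_iff.1 (hC.isOpen ⟨P, hP, z, δ, hδ, rfl⟩) z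
    ⟨z, by simpa [P.dist_self'] using hδ, rfl⟩

/-- The balls form a base only collectively, so the small ball around `z` may belong to another
piece `R`; quasi-local equality at `z` transfers it to `P`. -/
theorem exists_dist_lt_of_piece_dist_lt (hQ : IsQuasiLocalCover C)
    (hC : IsTopologicalBasis (balls C)) {P : MetricPiece Z} (hP : P ∈ C) (z : P.carrier)
    {ε : ℝ} (hε : 0 < ε) :
    ∃ δ > 0, ∀ y : P.carrier, P.dist z y < δ → dist (z : Z) y < ε := by
  obtain ⟨B, ⟨R, hR, w, r, hr, rfl⟩, ⟨z', hz', hzz'⟩, hB⟩ :=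
    hC.exists_subset_of_mem_open (Metric.mem_ball_self (x := (z : Z)) hε) Metric.isOpen_ball
  obtain ⟨-, δ, hδ, hcov⟩ := hQ
  have hzR : (z : Z) ∈ R.carrier := hzz' ▸ z'.2
  obtain rfl : z' = ⟨z, hzR⟩ := Subtype.ext hzz'
  obtain ⟨V, hzV, hVP, hVR, hV⟩ := hcov P hP R hR z ⟨z.2, hzR⟩
  obtain ⟨s, hs, hsV⟩ := MetricPiece.exists_dist_lt_of_isOpenIn hVP hzV
  rw [mem_ofPred_eq, R.dist_comm'] at hz'
  have hr' : 0 < r - R.dist w ⟨z, hzR⟩ := by linarith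
  refine ⟨min s (δ (r - R.dist w ⟨z, hzR⟩)), lt_min hs (hδ _ hr'), fun y hy => ?_⟩
  have hyV := hsV y (hy.trans_le (min_le_left _ _))
  have hyR := hVR.1 hyV
  have h1 := hV _ hr' z hzV y hyV z.2 y.2 hzR hyR (hy.trans_le (min_le_right _ _))
  have h2 := R.dist_triangle' w ⟨z, hzR⟩ ⟨y, hyR⟩
  have h3 : (y : Z) ∈ R.ball w r := ⟨⟨y, hyR⟩, by
    rw [mem_ofPred_eq, R.dist_comm']; linarith, rfl⟩
  rw [dist_comm]
  exact hB h3

/-- Every point of `K` has a neighborhood served by a single piece, and compactness leaves finitely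
many of them. -/
theorem exists_piece_dist_lt_of_dist_lt (hM : IsMetricCover C)
    (hC : IsTopologicalBasis (balls C)) {K : Set Z} (hK : IsCompact K) {ε : ℝ} (hε : 0 < ε) :
    ∃ δ > 0, ∀ x ∈ K, ∀ y, dist x y < δ → ∃ P ∈ C, ∃ (hx : x ∈ P.carrier) (hy : y ∈ P.carrier),
      P.dist ⟨x, hx⟩ ⟨y, hy⟩ < ε := by
  refine hK.induction_on ⟨1, one_pos, by simp⟩ ?_ ?_ ?_
  · rintro s t hst ⟨δ, hδ, h⟩
    exact ⟨δ, hδ, fun x hx => h x (hst hx)⟩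
  · rintro s t ⟨δ, hδ, h⟩ ⟨δ', hδ', h'⟩
    refine ⟨min δ δ', lt_min hδ hδ', fun x hx y hxy => ?_⟩
    rcases hx with hx | hx
    · exact h x hx y (hxy.trans_le (min_le_left _ _))
    · exact h' x hx y (hxy.trans_le (min_le_right _ _))
  · intro x₀ _
    obtain ⟨P, hP, hx₀⟩ := hM.1 x₀
    obtain ⟨r, hr, hrP⟩ := exists_ball_subset_ball hC hP ⟨x₀, hx₀⟩ (half_pos hε)
    refine ⟨Metric.ball x₀ (r / 2),
      mem_nhdsWithin_of_mem_nhds (Metric.ball_mem_nhds _ (half_pos hr)), r / 2, half_pos hr,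
      fun x hx y hxy => ?_⟩
    rw [Metric.mem_ball] at hx
    have hx' : x ∈ P.ball ⟨x₀, hx₀⟩ (ε / 2) := hrP (by rw [Metric.mem_ball]; linarith)
    have hy' : y ∈ P.ball ⟨x₀, hx₀⟩ (ε / 2) := hrP (by
      rw [Metric.mem_ball]; linarith [dist_triangle y x x₀, dist_comm x y])
    obtain ⟨x', hx1, rfl⟩ := hx'
    obtain ⟨y', hy1, rfl⟩ := hy'
    refine ⟨P, hP, x'.2, y'.2, ?_⟩
    have := P.dist_triangle' x' ⟨x₀, hx₀⟩ y'
    rw [P.dist_comm' ⟨x₀, hx₀⟩ y'] at this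
    exact this.trans_lt (by linarith [show P.dist x' _ < _ from hx1, show P.dist y' _ < _ from hy1])

theorem exists_lebesgue_number (hM : IsMetricCover C) (hC : IsTopologicalBasis (balls C))
    {K : Set Z} (hK : IsCompact K) :
    ∃ r > 0, ∀ x ∈ K, ∃ P ∈ C, Metric.ball x r ⊆ P.carrier := by
  have hopen : ∀ P : C, IsOpen (P : MetricPiece Z).carrier := by
    rintro ⟨P, hP⟩
    rw [Metric.isOpen_iff]
    intro x hx
    obtain ⟨r, hr, h⟩ := exists_ball_subset_ball hC hP ⟨x, hx⟩ one_pos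
    refine ⟨r, hr, h.trans ?_⟩
    rintro _ ⟨y, -, rfl⟩
    exact y.2
  obtain ⟨r, hr, h⟩ := lebesgue_number_lemma_of_metric hK hopen (fun x _ => by
    obtain ⟨P, hP, hx⟩ := hM.1 x
    exact mem_iUnion.2 ⟨⟨P, hP⟩, hx⟩)
  exact ⟨r, hr, fun x hx => let ⟨P, hP⟩ := h x hx; ⟨P, P.2, hP⟩⟩

/-- A strongly equicontinuous family is equicontinuous for any compatible metric near a compact
set, up to points whose images are far away. -/
theorem exists_equicontinuous (hQ : IsQuasiLocalCover C) (hC : IsTopologicalBasis (balls C))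
    {S : Set (OpenPartialHomeomorph Z Z)}
    (hS : ∀ ε > 0, ∃ δ > 0, ∀ h ∈ S, ∀ P ∈ C, ∀ R ∈ C,
        ∀ x ∈ h.source, ∀ y ∈ h.source,
          ∀ (hx : x ∈ P.carrier) (hy : y ∈ P.carrier)
            (hhx : h x ∈ R.carrier) (hhy : h y ∈ R.carrier),
            P.dist ⟨x, hx⟩ ⟨y, hy⟩ < δ → R.dist ⟨h x, hhx⟩ ⟨h y, hhy⟩ < ε)
    {K : Set Z} (hK : IsCompact K) :
    ∃ r > 0, ∀ ε > 0, ∃ δ > 0, ∀ h ∈ restrictions S, ∀ x ∈ h.source, ∀ y ∈ h.source,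
      x ∈ K → h x ∈ K → dist x y < δ → dist (h x) (h y) < r → dist (h x) (h y) < ε := by
  obtain ⟨r, hr, hrK⟩ := exists_lebesgue_number hQ.1 hC hK
  -- Half a Lebesgue number: for `u` near `u₀`, the `r / 2`-ball at `u` still lies in the piece
  -- chosen at `u₀`. The radius is fixed before `ε`.
  refine ⟨r / 2, half_pos hr, fun ε hε => ?_⟩
  have key : ∃ δ > 0, ∀ u ∈ K, ∃ P ∈ C, ∃ hu : u ∈ P.carrier, ∀ v, dist u v < r / 2 →
      ∃ hv : v ∈ P.carrier, P.dist ⟨u, hu⟩ ⟨v, hv⟩ < δ → dist u v < ε := by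
    refine hK.induction_on ⟨1, one_pos, by simp⟩ ?_ ?_ ?_
    · rintro s t hst ⟨δ, hδ, h⟩
      exact ⟨δ, hδ, fun x hx => h x (hst hx)⟩
    · rintro s t ⟨δ, hδ, h⟩ ⟨δ', hδ', h'⟩
      refine ⟨min δ δ', lt_min hδ hδ', fun x hx => ?_⟩
      rcases hx with hx | hx
      · obtain ⟨P, hP, hu, h⟩ := h x hx
        exact ⟨P, hP, hu, fun v hv => let ⟨h1, h2⟩ := h v hv
          ⟨h1, fun h3 => h2 (h3.trans_le (min_le_left _ _))⟩⟩
      · obtain ⟨P, hP, hu, h⟩ := h' x hx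
        exact ⟨P, hP, hu, fun v hv => let ⟨h1, h2⟩ := h v hv
          ⟨h1, fun h3 => h2 (h3.trans_le (min_le_right _ _))⟩⟩
    · intro u₀ hu₀
      obtain ⟨P, hP, hPr⟩ := hrK u₀ hu₀
      have hu₀P : u₀ ∈ P.carrier := hPr (Metric.mem_ball_self hr)
      obtain ⟨δ, hδ, hδP⟩ := exists_dist_lt_of_piece_dist_lt hQ hC hP ⟨u₀, hu₀P⟩ (half_pos hε)
      obtain ⟨s, hs, hsP⟩ := exists_ball_subset_ball hC hP ⟨u₀, hu₀P⟩ (half_pos hδ)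
      refine ⟨Metric.ball u₀ (min s (min (r / 2) (ε / 2))), mem_nhdsWithin_of_mem_nhds
        (Metric.ball_mem_nhds _ (by positivity)), δ / 2, half_pos hδ, fun u hu => ?_⟩
      simp only [Metric.mem_ball, lt_min_iff] at hu
      have huP : u ∈ P.carrier := hPr (by rw [Metric.mem_ball]; linarith)
      have hu1 : P.dist ⟨u₀, hu₀P⟩ ⟨u, huP⟩ < δ / 2 := by
        obtain ⟨u', hu', rfl⟩ := hsP (Metric.mem_ball.2 hu.1)
        rw [P.dist_comm']
        exact hu'
      refine ⟨P, hP, huP, fun v hv => ?_⟩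
      have hvP : v ∈ P.carrier := hPr (by
        rw [Metric.mem_ball]; linarith [dist_triangle v u u₀, dist_comm u v])
      refine ⟨hvP, fun h => ?_⟩
      have h1 := hδP ⟨v, hvP⟩ (by linarith [P.dist_triangle' ⟨u₀, hu₀P⟩ ⟨u, huP⟩ ⟨v, hvP⟩])
      simp only at h1
      linarith [dist_triangle u u₀ v]
  obtain ⟨δ₁, hδ₁, h₁⟩ := key
  obtain ⟨δ₂, hδ₂, h₂⟩ := hS δ₁ hδ₁
  obtain ⟨δ₃, hδ₃, h₃⟩ := exists_piece_dist_lt_of_dist_lt hQ.1 hC hK hδ₂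
  -- The bound `ε` serves restrictions of the identity, which need not lie in `S`.
  refine ⟨min δ₃ ε, lt_min hδ₃ hε, ?_⟩
  rintro h ⟨s, hs, hsub, heq⟩ x hx y hy hxK hhxK hxy hhxy
  rw [heq hx, heq hy] at hhxy ⊢
  rw [heq hx] at hhxK
  rcases hs with hs | rfl
  · obtain ⟨P, hP, hxP, hyP, hPxy⟩ := h₃ x hxK y (hxy.trans_le (min_le_left _ _))
    obtain ⟨R, hR, hxR, h⟩ := h₁ _ hhxK
    obtain ⟨hyR, h⟩ := h _ hhxy
    exact h (h₂ s hs P hP R hR x (hsub hx) y (hsub hy) hxP hyP hxR hyR hPxy)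
  · simpa using hxy.trans_le (min_le_right _ _)

end QuasiLocalMetric

/-! ### Uniform extension of germs -/

section Extension

variable {Z : Type u} [MetricSpace Z] {T : Set (OpenPartialHomeomorph Z Z)}

/-- An equicontinuous and quasi-effective family of local transformations, closed under
composition, inversion and restriction, whose germs between points of `U` extend to balls of
radius `δ₀`. -/
structure IsUniformlyExtendable (T : Set (OpenPartialHomeomorph Z Z)) (U : Set Z) (δ₀ r : ℝ) :
    Prop extends IsRestrictionClosed T where
  radius_pos : 0 < δ₀
  effective : ∀ h ∈ T, ∀ x ∈ h.source, h =ᶠ[𝓝 x] id → EqOn h id h.source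
  equicontinuous : ∀ ε > 0, ∃ δ > 0, ∀ h ∈ T, ∀ x ∈ h.source, ∀ y ∈ h.source,
    x ∈ U → h x ∈ U → dist x y < δ → dist (h x) (h y) < r → dist (h x) (h y) < ε
  extend : ∀ h ∈ T, ∀ x ∈ h.source, x ∈ U → h x ∈ U → ∃ k ∈ T, k.source = Metric.ball x δ₀ ∧
    k =ᶠ[𝓝 x] h ∧ ∀ y ∈ Metric.ball x δ₀, dist (h x) (k y) < r

theorem eventually_restr_ball_mem {H : StructureGroupoid Z} (hT : IsRestrictionClosed T)
    (hHT : ∀ h ∈ H, ∀ x ∈ h.source, ∃ s, IsOpen s ∧ x ∈ s ∧ h.restr s ∈ T)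
    {g : OpenPartialHomeomorph Z Z} (hg : g ∈ H) {K : Set Z} (hK : IsCompact K)
    (hKg : K ⊆ g.source) {r : ℝ} (hr : 0 < r) :
    ∀ᶠ l in 𝓝[>] (0 : ℝ), ∀ x ∈ K, Metric.ball x l ⊆ g.source ∧ g.restr (Metric.ball x l) ∈ T ∧
      ∀ y ∈ Metric.ball x l, dist (g x) (g y) < r := by
  have mono : ∀ l l' : ℝ, l ≤ l' → ∀ x, (Metric.ball x l' ⊆ g.source ∧
      g.restr (Metric.ball x l') ∈ T ∧ ∀ y ∈ Metric.ball x l', dist (g x) (g y) < r) →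
      (Metric.ball x l ⊆ g.source ∧
      g.restr (Metric.ball x l) ∈ T ∧ ∀ y ∈ Metric.ball x l, dist (g x) (g y) < r) := by
    rintro l l' hl x ⟨h1, h2, h3⟩
    have hb : Metric.ball x l ⊆ Metric.ball x l' := Metric.ball_subset_ball hl
    refine ⟨hb.trans h1, hT.sub_mem _ h2 _ ?_ (fun _ _ => rfl), fun y hy => h3 y (hb hy)⟩
    simp only [OpenPartialHomeomorph.restr_source, Metric.isOpen_ball.interior_eq]
    exact inter_subset_inter_right _ hb
  suffices h : ∃ l > 0, ∀ x ∈ K, Metric.ball x l ⊆ g.source ∧ g.restr (Metric.ball x l) ∈ T ∧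
      ∀ y ∈ Metric.ball x l, dist (g x) (g y) < r by
    obtain ⟨l, hl, h⟩ := h
    filter_upwards [Ioo_mem_nhdsGT hl] with l' hl' x hx
    exact mono l' l hl'.2.le x (h x hx)
  refine hK.induction_on ⟨1, one_pos, by simp⟩ ?_ ?_ ?_
  · rintro s t hst ⟨δ, hδ, h⟩
    exact ⟨δ, hδ, fun x hx => h x (hst hx)⟩
  · rintro s t ⟨δ, hδ, h⟩ ⟨δ', hδ', h'⟩
    refine ⟨min δ δ', lt_min hδ hδ', fun x hx => ?_⟩
    rcases hx with hx | hx
    · exact mono _ _ (min_le_left _ _) x (h x hx)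
    · exact mono _ _ (min_le_right _ _) x (h' x hx)
  · intro x₀ hx₀
    obtain ⟨s, hs, hxs, hgs⟩ := hHT g hg x₀ (hKg hx₀)
    have hcont : ∀ᶠ y in 𝓝 x₀, dist (g y) (g x₀) < r / 2 :=
      (g.continuousAt (hKg hx₀)) (Metric.ball_mem_nhds _ (half_pos hr))
    obtain ⟨l, hl, hball⟩ := Metric.eventually_nhds_iff_ball.1
      (hcont.and ((hs.inter g.open_source).mem_nhds ⟨hxs, hKg hx₀⟩))
    refine ⟨Metric.ball x₀ (l / 2), mem_nhdsWithin_of_mem_nhds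
      (Metric.ball_mem_nhds _ (half_pos hl)), l / 2, half_pos hl, fun x hx => ?_⟩
    have hb : Metric.ball x (l / 2) ⊆ Metric.ball x₀ l := fun y hy => by
      rw [Metric.mem_ball] at *
      linarith [dist_triangle y x x₀]
    refine ⟨fun y hy => (hball y (hb hy)).2.2, hT.sub_mem _ hgs _ ?_ (fun _ _ => rfl), ?_⟩
    · intro y hy
      simp only [OpenPartialHomeomorph.restr_source, Metric.isOpen_ball.interior_eq,
        hs.interior_eq] at hy ⊢
      exact ⟨hy.1, (hball y (hb hy.2)).2.1⟩
    · intro y hy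
      have h1 := (hball y (hb hy)).1
      have h2 := (hball x (hb (Metric.mem_ball_self (half_pos hl)))).1
      linarith [dist_triangle_right (g x) (g y) (g x₀)]

/-- Induction on words does not shrink the radius. Appending a generator spreads the image of the
ball to at most `r`; but the composite is again in `T` and maps its center from `U` into `U`, so
equicontinuity brings the spread back below `l`. -/
theorem exists_isUniformlyExtendable {H : StructureGroupoid Z} (hT : IsRestrictionClosed T)
    (hTH : T ⊆ {h | h ∈ H})
    (hHT : ∀ h ∈ H, ∀ x ∈ h.source, ∃ s, IsOpen s ∧ x ∈ s ∧ h.restr s ∈ T)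
    [ClosedUnderRestriction H]
    (heff : ∀ h ∈ T, ∀ x ∈ h.source, h =ᶠ[𝓝 x] id → EqOn h id h.source)
    {U : Opens Z} (hU : IsCompact (closure (U : Set Z))) {E : Set (OpenPartialHomeomorph Z Z)}
    (hfin : E.Finite) (hE : IsSymmetric E) (hgen : IsGeneratedOn U (restrictTo H U) E)
    (hext : ∀ g ∈ E, ∃ gbar ∈ H, closure g.source ⊆ gbar.source ∧ EqOn gbar g g.source)
    {r : ℝ} (hr : 0 < r) (heq : ∀ ε > 0, ∃ δ > 0, ∀ h ∈ T, ∀ x ∈ h.source, ∀ y ∈ h.source,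
      x ∈ (U : Set Z) → h x ∈ (U : Set Z) → dist x y < δ → dist (h x) (h y) < r →
        dist (h x) (h y) < ε) :
    ∃ δ₀, IsUniformlyExtendable T U δ₀ r := by
  have hEU : ∀ g ∈ E, g.source ⊆ U ∧ g.target ⊆ U := fun g hg => (hgen.1 hg).2
  choose! gbar hgbar hsub heqOn using hext
  -- One `l` works for all generators: `E` is finite and the closures of their domains are compact.
  obtain ⟨l, ⟨hl0, hlr⟩, hl⟩ : ∃ l : ℝ, l ∈ Ioo 0 r ∧ ∀ g ∈ E, ∀ x ∈ closure g.source,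
      Metric.ball x l ⊆ (gbar g).source ∧ (gbar g).restr (Metric.ball x l) ∈ T ∧
      ∀ y ∈ Metric.ball x l, dist (gbar g x) (gbar g y) < r := by
    have hIoo : ∀ᶠ l in 𝓝[>] (0 : ℝ), l ∈ Ioo 0 r := Ioo_mem_nhdsGT hr
    refine (hIoo.and ((Filter.eventually_all_finite hfin).2 fun g hg => ?_)).exists
    exact eventually_restr_ball_mem hT hHT (hgbar g hg)
      (hU.of_isClosed_subset isClosed_closure (closure_mono (hEU g hg).1)) (hsub g hg) hr
  obtain ⟨δ, hδ, heqδ⟩ := heq l hl0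
  have hδ₀ : 0 < min δ l := lt_min hδ hl0
  have key : ∀ w, IsWord E w → ∀ x ∈ w.source, x ∈ (U : Set Z) → w x ∈ (U : Set Z) ∧ ∃ k ∈ T,
      k.source = Metric.ball x (min δ l) ∧ k =ᶠ[𝓝 x] w ∧
      ∀ y ∈ Metric.ball x (min δ l), dist (w x) (k y) < l := by
    intro w hw
    induction hw with
    | refl =>
      refine fun x _ hxU => ⟨hxU, (OpenPartialHomeomorph.refl Z).restr (Metric.ball x (min δ l)),
        hT.restr_mem hT.refl_mem _, ?_, Filter.EventuallyEq.rfl, ?_⟩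
      · simp [Metric.isOpen_ball.interior_eq]
      · intro y hy
        rw [Metric.mem_ball, dist_comm] at hy
        exact hy.trans_le (min_le_right _ _)
    | @trans w g _ hg ih =>
      intro x hx hxU
      rw [OpenPartialHomeomorph.trans_source] at hx
      obtain ⟨hwx, k, hkT, hks, hkw, hk⟩ := ih x hx.1 hxU
      have hgwx : w x ∈ g.source := hx.2
      obtain ⟨h1, h2, h3⟩ := hl g hg (w x) (subset_closure hgwx)
      have hgU : g (w x) ∈ (U : Set Z) := (hEU g hg).2 (g.map_source hgwx)
      have hxb : x ∈ Metric.ball x (min δ l) := Metric.mem_ball_self hδ₀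
      have hgb : gbar g (w x) = g (w x) := heqOn g hg hgwx
      have hkx : k x = w x := hkw.eq_of_nhds
      have hsrc : (k.trans ((gbar g).restr (Metric.ball (w x) l))).source =
          Metric.ball x (min δ l) := by
        rw [OpenPartialHomeomorph.trans_source, hks, inter_eq_left]
        intro y hy
        have hy' : k y ∈ Metric.ball (w x) l := by
          rw [Metric.mem_ball, dist_comm]; exact hk y hy
        simp only [mem_preimage, OpenPartialHomeomorph.restr_source,
          Metric.isOpen_ball.interior_eq]
        exact ⟨h1 hy', hy'⟩
      have hmem := hT.comp_mem _ hkT _ h2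
      refine ⟨hgU, _, hmem, hsrc, ?_, ?_⟩
      · have hc : Filter.Tendsto w (𝓝 x) (𝓝 (w x)) := w.continuousAt hx.1
        filter_upwards [hkw, hc (g.open_source.mem_nhds hgwx)] with y hy hy'
        show gbar g (k y) = g (w y)
        rw [hy]
        exact heqOn g hg hy'
      · intro y hy
        have hy' : k y ∈ Metric.ball (w x) l := by
          rw [Metric.mem_ball, dist_comm]; exact hk y hy
        -- The a priori bound `r` required here comes from `h3`, the spread of the last generator on
        -- an `l`-ball.
        have h4 := heqδ _ hmem x (hsrc ▸ hxb) y (hsrc ▸ hy) hxU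
        simp only [OpenPartialHomeomorph.coe_trans, Function.comp_apply,
          OpenPartialHomeomorph.restr_apply, hkx, hgb] at h4 ⊢
        refine h4 hgU ?_ ?_
        · rw [Metric.mem_ball, dist_comm] at hy
          exact hy.trans_le (min_le_left _ _)
        · have := h3 _ hy'
          rwa [hgb] at this
  refine ⟨min δ l, hT, hδ₀, heff, heq, fun h hh x hx hxU hhxU => ?_⟩
  -- Cutting `h` down to a map between open subsets of `U` makes its germ at `x` the germ of a word.
  have ho : IsOpen ((U : Set Z) ∩ (h.source ∩ h ⁻¹' U)) :=
    U.isOpen.inter (h.isOpen_inter_preimage U.isOpen)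
  have hG : h.restr ((U : Set Z) ∩ (h.source ∩ h ⁻¹' U)) ∈ restrictTo H U := by
    refine ⟨closedUnderRestriction' (hTH hh) ho, ?_, ?_⟩
    · rw [OpenPartialHomeomorph.restr_source, ho.interior_eq]
      exact fun y hy => hy.2.1
    · rw [← OpenPartialHomeomorph.image_source_eq_target, OpenPartialHomeomorph.restr_source,
        ho.interior_eq]
      rintro _ ⟨y, hy, rfl⟩
      exact hy.2.2.2
  obtain ⟨w, hw, hxw, hwh⟩ := hgen.exists_isWord (fun g hg => hg.2) hE hG (x := x) (by
    rw [OpenPartialHomeomorph.restr_source, ho.interior_eq]; exact ⟨hx, hxU, hx, hhxU⟩)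
  obtain ⟨-, k, hkT, hks, hkw, hk⟩ := key w hw x hxw hxU
  refine ⟨k, hkT, hks, hkw.trans hwh, fun y hy => ?_⟩
  have : w x = h x := hwh.eq_of_nhds
  rw [← this]
  exact (hk y hy).trans hlr

namespace IsUniformlyExtendable

variable {U : Set Z} {δ₀ r : ℝ}

/-- The inverse germ at `k x` extends to some `k'` on a ball. Where `k ∘ k'` is defined it is the
identity by quasi-effectiveness, and equicontinuity of `k'` makes it defined on a ball of uniform
radius. -/
theorem exists_ball_subset_target (hT : IsUniformlyExtendable T U δ₀ r) :
    ∃ ε₁ > 0, ∀ k ∈ T, ∀ x, k.source = Metric.ball x δ₀ → x ∈ U → k x ∈ U →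
      Metric.ball (k x) ε₁ ⊆ k.target := by
  obtain ⟨δ, hδ, heq⟩ := hT.equicontinuous δ₀ hT.radius_pos
  refine ⟨min δ δ₀, lt_min hδ hT.radius_pos, fun k hk x hks hxU hkxU v hv => ?_⟩
  have hx : x ∈ k.source := hks ▸ Metric.mem_ball_self hT.radius_pos
  have hkx : k.symm (k x) = x := k.left_inv hx
  obtain ⟨k', hk', hks', hkk', hr⟩ := hT.extend k.symm (hT.symm_mem k hk) (k x)
    (k.map_source hx) hkxU (hkx.symm ▸ hxU)
  have hk'x : k' (k x) = x := hkk'.eq_of_nhds.trans hkx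
  have hkx' : k x ∈ k'.source := hks' ▸ Metric.mem_ball_self hT.radius_pos
  have hvs : v ∈ k'.source := hks' ▸ Metric.ball_subset_ball (min_le_right _ _) hv
  have hv' : k' v ∈ k.source := by
    rw [hks, Metric.mem_ball, dist_comm]
    have := heq k' hk' (k x) hkx' v hvs hkxU (hk'x.symm ▸ hxU)
    rw [hk'x] at this
    refine this ?_ ?_
    · rw [Metric.mem_ball, dist_comm] at hv
      exact hv.trans_le (min_le_left _ _)
    · have := hr v (hks' ▸ hvs)
      rwa [hkx] at this
  have hid := hT.effective _ (hT.comp_mem k' hk' k hk) (k x)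
    (by rw [OpenPartialHomeomorph.trans_source]; exact ⟨hkx', by rwa [mem_preimage, hk'x]⟩) (by
      filter_upwards [hkk', k.open_target.mem_nhds (k.map_source hx)] with y hy hyt
      show k (k' y) = y
      rw [hy, k.right_inv hyt])
    (by rw [OpenPartialHomeomorph.trans_source]; exact ⟨hvs, hv'⟩ : v ∈ (k'.trans k).source)
  have hid' : k (k' v) = v := hid
  rw [← hid']
  exact k.map_source hv'

/-- An element of the family mapping a point of `U` into `U` agrees at any second point, provided
that the images of both points are close, with an element defined on a ball. -/
theorem exists_extension_eq (hT : IsUniformlyExtendable T U δ₀ r) :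
    ∃ ε₁ > 0, (∀ m ∈ T, ∀ x ∈ m.source, ∀ z ∈ m.source, x ∈ U → m x ∈ U →
      dist (m x) (m z) < ε₁ → ∃ k ∈ T, k.source = Metric.ball x δ₀ ∧ k x = m x ∧ k z = m z ∧
        z ∈ k.source ∧ ∀ y ∈ k.source, dist (k x) (k y) < r) := by
  obtain ⟨ε₁, hε₁, h⟩ := hT.exists_ball_subset_target
  refine ⟨ε₁, hε₁, fun m hm x hx z hz hxU hmxU hxz => ?_⟩
  obtain ⟨k, hk, hks, hkm, hr⟩ := hT.extend m hm x hx hxU hmxU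
  have hkx : k x = m x := hkm.eq_of_nhds
  have hxk : x ∈ k.source := hks ▸ Metric.mem_ball_self hT.radius_pos
  have hmz : m z ∈ k.target := h k hk x hks hxU (hkx.symm ▸ hmxU) (by
    rwa [Metric.mem_ball, dist_comm, hkx])
  -- The composite of `m` with `k.symm` has trivial germ at `x`, so it also fixes `z`, even if `z`
  -- is far from `x` within the domain of `m`.
  have hid : k.symm (m z) = z := hT.effective _ (hT.comp_mem m hm k.symm (hT.symm_mem k hk)) x
    (by rw [OpenPartialHomeomorph.trans_source]
        exact ⟨hx, by rw [mem_preimage, ← hkx]; exact k.map_source hxk⟩) (by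
      filter_upwards [hkm, k.open_source.mem_nhds hxk] with y hy hyt
      show k.symm (m y) = y
      rw [← hy, k.left_inv hyt])
    (by rw [OpenPartialHomeomorph.trans_source]; exact ⟨hz, hmz⟩ : z ∈ (m.trans k.symm).source)
  refine ⟨k, hk, hks, hkx, ?_, ?_, fun y hy => ?_⟩
  · rw [← k.right_inv hmz, hid]
  · rw [← hid]; exact k.map_target hmz
  · rw [hkx]; exact hr y (hks ▸ hy)

end IsUniformlyExtendable

end Extension

/-! ### Functions that restrict to compatible metrics -/

section CompatibleDistance

variable {Z : Type u} [TopologicalSpace Z]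

/-- The function `d` restricts to a metric on the open set `V` that induces the topology of `V`. -/
structure IsCompatibleOn (d : Z → Z → ℝ) (V : Set Z) : Prop where
  isOpen : IsOpen V
  dist_self : ∀ x ∈ V, d x x = 0
  dist_comm : ∀ x ∈ V, ∀ y ∈ V, d x y = d y x
  dist_triangle : ∀ x ∈ V, ∀ y ∈ V, ∀ z ∈ V, d x z ≤ d x y + d y z
  eventually_lt : ∀ x ∈ V, ∀ ε > 0, ∀ᶠ y in 𝓝 x, d x y < ε
  exists_lt : ∀ x ∈ V, ∀ N ∈ 𝓝 x, ∃ ε > 0, ∀ y ∈ V, d x y < ε → y ∈ N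

theorem IsCompatibleOn.preimage {d : Z → Z → ℝ} {V : Set Z} (hV : IsCompatibleOn d V)
    (g : OpenPartialHomeomorph Z Z)
    (hg : ∀ x ∈ g.source, ∀ y ∈ g.source, d (g x) (g y) = d x y) :
    IsCompatibleOn d (g.source ∩ g ⁻¹' V) where
  isOpen := g.isOpen_inter_preimage hV.isOpen
  dist_self x hx := by rw [← hg x hx.1 x hx.1]; exact hV.dist_self _ hx.2
  dist_comm x hx y hy := by
    rw [← hg x hx.1 y hy.1, ← hg y hy.1 x hx.1]; exact hV.dist_comm _ hx.2 _ hy.2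
  dist_triangle x hx y hy z hz := by
    rw [← hg x hx.1 y hy.1, ← hg y hy.1 z hz.1, ← hg x hx.1 z hz.1]
    exact hV.dist_triangle _ hx.2 _ hy.2 _ hz.2
  eventually_lt x hx ε hε := by
    filter_upwards [(g.continuousAt hx.1).eventually (hV.eventually_lt _ hx.2 ε hε),
      g.open_source.mem_nhds hx.1] with y hy hys
    rwa [← hg x hx.1 y hys]
  exists_lt x hx N hN := by
    have hc := g.symm.continuousAt (x := g x) (g.map_source hx.1)
    rw [ContinuousAt, g.left_inv hx.1] at hc
    obtain ⟨ε, hε, h⟩ := hV.exists_lt _ hx.2 _ (hc hN)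
    refine ⟨ε, hε, fun y hy hxy => ?_⟩
    rw [← hg x hx.1 y hy.1] at hxy
    have := h _ hy.2 hxy
    rwa [mem_preimage, g.left_inv hy.1] at this

end CompatibleDistance

/-! ### Construction of the invariant distance -/

section InvariantDistance

variable {Z : Type u} [MetricSpace Z]

/-- The distance in the quotient of `Z` by the zero set of `θ`. -/
noncomputable def cutDist (θ : Z → ℝ) (u v : Z) : ℝ := min (dist u v) (θ u + θ v)

/-- The distance to the complement works, except for `U = univ`: `infDist` to the empty set is `0`,
so a constant is used there. -/
theorem exists_lipschitz_pos_iff {U : Set Z} (hU : IsOpen U) :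
    ∃ θ : Z → ℝ, (∀ u, 0 ≤ θ u) ∧ (∀ u v, θ u ≤ θ v + dist u v) ∧ ∀ u, 0 < θ u ↔ u ∈ U := by
  rcases eq_empty_or_nonempty Uᶜ with h | h
  · refine ⟨fun _ => 1, fun _ => zero_le_one, fun u v => by simp, fun u => ?_⟩
    rw [compl_empty_iff] at h
    simp [h]
  · refine ⟨fun u => Metric.infDist u Uᶜ, fun _ => Metric.infDist_nonneg,
      fun u v => Metric.infDist_le_infDist_add_dist, fun u => ?_⟩
    rw [← hU.isClosed_compl.notMem_iff_infDist_pos h, notMem_compl_iff]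

variable {θ : Z → ℝ}

theorem cutDist_comm (u v : Z) : cutDist θ u v = cutDist θ v u := by
  rw [cutDist, cutDist, dist_comm, add_comm]

theorem cutDist_nonneg (h0 : ∀ u, 0 ≤ θ u) (u v : Z) : 0 ≤ cutDist θ u v :=
  le_min dist_nonneg (add_nonneg (h0 u) (h0 v))

theorem cutDist_triangle (h0 : ∀ u, 0 ≤ θ u) (h1 : ∀ u v, θ u ≤ θ v + dist u v) (u v w : Z) :
    cutDist θ u w ≤ cutDist θ u v + cutDist θ v w := by
  have := h1 u v
  have := h1 w v
  have := dist_comm w v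
  have := dist_triangle u v w
  have := h0 v
  have hd := min_le_left (dist u w) (θ u + θ w)
  have ht := min_le_right (dist u w) (θ u + θ w)
  unfold cutDist
  rcases min_choice (dist u v) (θ u + θ v) with h | h <;>
  rcases min_choice (dist v w) (θ v + θ w) with h' | h' <;> rw [h, h'] <;> linarith

variable {T : Set (OpenPartialHomeomorph Z Z)} {ε₁ : ℝ}

/-- The largest distance, with respect to `cutDist θ`, of the images of two points under the
elements of `T` for which these images are `ε₁`-close. -/
noncomputable def supDist (T : Set (OpenPartialHomeomorph Z Z)) (θ : Z → ℝ) (ε₁ : ℝ) (x y : Z) :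
    ℝ :=
  sSup {a | ∃ m ∈ T, x ∈ m.source ∧ y ∈ m.source ∧ dist (m x) (m y) < ε₁ ∧
    a = cutDist θ (m x) (m y)}

/-- The threshold `ε₁` bounds the set of values, so the supremum is genuine. -/
theorem cutDist_le_supDist {m : OpenPartialHomeomorph Z Z} (hm : m ∈ T) {x y : Z}
    (hx : x ∈ m.source) (hy : y ∈ m.source) (hxy : dist (m x) (m y) < ε₁) :
    cutDist θ (m x) (m y) ≤ supDist T θ ε₁ x y := by
  refine le_csSup ⟨ε₁, ?_⟩ ⟨m, hm, hx, hy, hxy, rfl⟩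
  rintro _ ⟨m, -, -, -, h, rfl⟩
  exact (min_le_left _ _).trans h.le

/-- The condition `0 ≤ a` accounts for pairs with no admissible `m`, where `sSup ∅ = 0`. -/
theorem supDist_le {x y : Z} {a : ℝ} (ha : 0 ≤ a) (h : ∀ m ∈ T, x ∈ m.source → y ∈ m.source →
    dist (m x) (m y) < ε₁ → cutDist θ (m x) (m y) ≤ a) : supDist T θ ε₁ x y ≤ a := by
  refine Real.sSup_le ?_ ha
  rintro _ ⟨m, h1, h2, h3, h4, rfl⟩
  exact h m h1 h2 h3 h4

theorem supDist_nonneg (h0 : ∀ u, 0 ≤ θ u) (x y : Z) : 0 ≤ supDist T θ ε₁ x y := by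
  refine Real.sSup_nonneg ?_
  rintro _ ⟨m, -, -, -, -, rfl⟩
  exact cutDist_nonneg h0 _ _

theorem supDist_comm (h0 : ∀ u, 0 ≤ θ u) (x y : Z) :
    supDist T θ ε₁ x y = supDist T θ ε₁ y x := by
  have key : ∀ x y, supDist T θ ε₁ x y ≤ supDist T θ ε₁ y x := fun x y =>
    supDist_le (supDist_nonneg h0 _ _) fun m hm hx hy hxy => by
      rw [cutDist_comm]
      rw [dist_comm] at hxy
      exact cutDist_le_supDist hm hy hx hxy
  exact le_antisymm (key x y) (key y x)

theorem supDist_self (h0 : ∀ u, 0 ≤ θ u) (x : Z) : supDist T θ ε₁ x x = 0 :=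
  le_antisymm (supDist_le le_rfl fun _ _ _ _ _ => (min_le_left _ _).trans (dist_self _).le)
    (supDist_nonneg h0 _ _)

/-- Precomposition with `g` turns competitors for the image pair into competitors for the original
pair; `g.symm` gives the reverse inequality. -/
theorem supDist_map (hT : IsRestrictionClosed T) (h0 : ∀ u, 0 ≤ θ u)
    {g : OpenPartialHomeomorph Z Z} (hg : g ∈ T) {x y : Z} (hx : x ∈ g.source)
    (hy : y ∈ g.source) : supDist T θ ε₁ (g x) (g y) = supDist T θ ε₁ x y := by
  have key : ∀ g ∈ T, ∀ x ∈ g.source, ∀ y ∈ g.source,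
      supDist T θ ε₁ (g x) (g y) ≤ supDist T θ ε₁ x y := fun g hg x hx y hy =>
    supDist_le (supDist_nonneg h0 _ _) fun m hm hmx hmy hxy =>
      cutDist_le_supDist (m := g.trans m) (hT.comp_mem g hg m hm)
        (by rw [OpenPartialHomeomorph.trans_source]; exact ⟨hx, hmx⟩)
        (by rw [OpenPartialHomeomorph.trans_source]; exact ⟨hy, hmy⟩) hxy
  refine le_antisymm (key g hg x hx y hy) ?_
  have := key g.symm (hT.symm_mem g hg) (g x) (g.map_source hx) (g y) (g.map_source hy)
  rwa [g.left_inv hx, g.left_inv hy] at this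

/-- `cutDist` vanishes when both images lie outside `U`. So one image may be taken in `U`, as the
extension results require. -/
theorem supDist_le_of_mem {U : Set Z} (hθ : ∀ u, 0 < θ u ↔ u ∈ U) {x y : Z}
    {a : ℝ} (ha : 0 ≤ a)
    (hx : ∀ m ∈ T, x ∈ m.source → y ∈ m.source → dist (m x) (m y) < ε₁ → m x ∈ U →
      cutDist θ (m x) (m y) ≤ a)
    (hy : ∀ m ∈ T, y ∈ m.source → x ∈ m.source → dist (m y) (m x) < ε₁ → m y ∈ U →
      cutDist θ (m y) (m x) ≤ a) : supDist T θ ε₁ x y ≤ a := by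
  refine supDist_le ha fun m hm hmx hmy hxy => ?_
  by_cases hxU : m x ∈ U
  · exact hx m hm hmx hmy hxy hxU
  by_cases hyU : m y ∈ U
  · rw [cutDist_comm]
    rw [dist_comm] at hxy
    exact hy m hm hmy hmx hxy hyU
  · rw [← hθ, not_lt] at hxU hyU
    exact (min_le_right _ _).trans (by linarith)

/-- A uniformly extendable family has an invariant distance that is a compatible metric near every
point of `U`. -/
theorem IsUniformlyExtendable.exists_invariant_dist {U : Set Z} (hU : IsOpen U) {δ₀ r : ℝ}
    (hT : IsUniformlyExtendable T U δ₀ r) :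
    ∃ d : Z → Z → ℝ, (∀ g ∈ T, ∀ x ∈ g.source, ∀ y ∈ g.source, d (g x) (g y) = d x y) ∧
      ∀ x ∈ U, ∃ V, x ∈ V ∧ IsCompatibleOn d V := by
  obtain ⟨θ, h0, h1, hθ⟩ := exists_lipschitz_pos_iff hU
  obtain ⟨ε₁, hε₁, hext⟩ := hT.exists_extension_eq
  refine ⟨supDist T θ ε₁, fun g hg x hx y hy => supDist_map hT.toIsRestrictionClosed h0 hg hx hy,
    fun x₀ hx₀ => ?_⟩
  have hsmall : ∀ ε > 0, ∃ δ > 0, ∀ x ∈ U, ∀ y ∈ U, dist x y < δ → supDist T θ ε₁ x y ≤ ε := by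
    intro ε hε
    obtain ⟨δ, hδ, heq⟩ := hT.equicontinuous ε hε
    have key : ∀ x ∈ U, ∀ y, dist x y < δ → ∀ m ∈ T, x ∈ m.source → y ∈ m.source →
        dist (m x) (m y) < ε₁ → m x ∈ U → cutDist θ (m x) (m y) ≤ ε := by
      intro x hx y hxy m hm hmx hmy hmxy hmxU
      obtain ⟨k, hk, hks, hkx, hky, hyk, hr⟩ := hext m hm x hmx y hmy hx hmxU hmxy
      rw [← hkx] at hmxU
      rw [← hkx, ← hky]
      exact (min_le_left _ _).trans (heq k hk x (hks ▸ Metric.mem_ball_self hT.radius_pos) y hyk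
        hx hmxU hxy (hr y hyk)).le
    refine ⟨δ, hδ, fun x hx y hy hxy => supDist_le_of_mem hθ hε.le (key x hx y hxy) ?_⟩
    rw [dist_comm] at hxy
    exact key y hy x hxy
  have htri : ∃ δ > 0, ∀ x ∈ U, ∀ z ∈ U, ∀ y, dist x y < δ → dist x z < δ → dist z y < δ →
      supDist T θ ε₁ x z ≤ supDist T θ ε₁ x y + supDist T θ ε₁ y z := by
    -- Replacing `m` by its extension `k` makes the middle point `y` available. With `k y` and `k z`
    -- both within `ε₁ / 2` of `k x`, all three images are pairwise `ε₁`-close, so `k` competes in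
    -- both suprema on the right.
    obtain ⟨δ, hδ, heq⟩ := hT.equicontinuous (ε₁ / 2) (half_pos hε₁)
    have key : ∀ x ∈ U, ∀ y z, dist x y < min δ δ₀ → dist x z < min δ δ₀ → ∀ m ∈ T,
        x ∈ m.source → z ∈ m.source → dist (m x) (m z) < ε₁ → m x ∈ U →
        cutDist θ (m x) (m z) ≤ supDist T θ ε₁ x y + supDist T θ ε₁ y z := by
      intro x hx y z hxy hxz m hm hmx hmz hmxz hmxU
      obtain ⟨k, hk, hks, hkx, hkz, hzk, hr⟩ := hext m hm x hmx z hmz hx hmxU hmxz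
      rw [← hkx] at hmxU
      rw [← hkx, ← hkz]
      have hxk : x ∈ k.source := hks ▸ Metric.mem_ball_self hT.radius_pos
      have hyk : y ∈ k.source := by
        rw [hks, Metric.mem_ball, dist_comm]
        exact hxy.trans_le (min_le_right _ _)
      have hdy := heq k hk x hxk y hyk hx hmxU (hxy.trans_le (min_le_left _ _)) (hr y hyk)
      have hdz := heq k hk x hxk z hzk hx hmxU (hxz.trans_le (min_le_left _ _)) (hr z hzk)
      refine (cutDist_triangle h0 h1 _ (k y) _).trans (add_le_add
        (cutDist_le_supDist hk hxk hyk (by linarith)) (cutDist_le_supDist hk hyk hzk ?_))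
      linarith [dist_triangle_left (k y) (k z) (k x)]
    refine ⟨min δ δ₀, lt_min hδ hT.radius_pos, fun x hx z hz y hxy hxz hzy =>
      supDist_le_of_mem hθ (add_nonneg (supDist_nonneg h0 _ _) (supDist_nonneg h0 _ _))
        (key x hx y z hxy hxz) ?_⟩
    rw [add_comm, supDist_comm h0 x y, supDist_comm h0 y z]
    rw [dist_comm] at hxz
    exact key z hz y x hzy hxz
  obtain ⟨δ, hδ, htri⟩ := htri
  -- `δ` is for the triangle inequality; `ε₁` lets the identity compete, which bounds `supDist`
  -- below by `cutDist`.
  have hV : ∀ x ∈ U ∩ Metric.ball x₀ (min δ ε₁ / 2), ∀ y ∈ U ∩ Metric.ball x₀ (min δ ε₁ / 2),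
      dist x y < min δ ε₁ := fun x hx y hy => by
    linarith [dist_triangle_right x y x₀, Metric.mem_ball.1 hx.2, Metric.mem_ball.1 hy.2]
  refine ⟨U ∩ Metric.ball x₀ (min δ ε₁ / 2), ⟨hx₀, Metric.mem_ball_self (by positivity)⟩,
    hU.inter Metric.isOpen_ball, fun x _ => supDist_self h0 x, fun x _ y _ => supDist_comm h0 x y,
    fun x hx y hy z hz => ?_, fun x hx ε hε => ?_, fun x hx N hN => ?_⟩
  · exact htri x hx.1 z hz.1 y ((hV x hx y hy).trans_le (min_le_left _ _))
      ((hV x hx z hz).trans_le (min_le_left _ _)) ((hV z hz y hy).trans_le (min_le_left _ _))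
  · obtain ⟨s, hs, h⟩ := hsmall (ε / 2) (half_pos hε)
    filter_upwards [hU.mem_nhds hx.1, Metric.ball_mem_nhds x hs] with y hy hys
    rw [Metric.mem_ball, dist_comm] at hys
    exact (h x hx.1 y hy hys).trans_lt (half_lt_self hε)
  · obtain ⟨s, hs, hN⟩ := Metric.mem_nhds_iff.1 hN
    -- Below `θ x` the term `θ x + θ y` cannot be the minimum, so `cutDist` is the original
    -- distance.
    refine ⟨min s (θ x), lt_min hs ((hθ x).2 hx.1), fun y hy hxy => hN ?_⟩
    have hle : cutDist θ x y ≤ supDist T θ ε₁ x y :=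
      cutDist_le_supDist (m := OpenPartialHomeomorph.refl Z) hT.refl_mem (mem_univ _) (mem_univ _)
        ((hV x hx y hy).trans_le (min_le_right _ _))
    have hlt := hle.trans_lt hxy
    rw [cutDist, lt_min_iff, min_lt_iff, min_lt_iff] at hlt
    rw [Metric.mem_ball, dist_comm]
    rcases hlt.1 with h | h
    · exact h
    · rcases hlt.2 with h' | h' <;> linarith [h0 y]

end InvariantDistance

/-! ### From an invariant distance to a local metric -/

section LocalMetricOfDistance

variable {Z : Type u}

theorem MetricPiece.restrict_topology (P : MetricPiece Z) (A : Set Z) (hA : A ⊆ P.carrier) :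
    (P.restrict A hA).toPseudoMetricSpace.toUniformSpace.toTopologicalSpace =
      P.topology.induced (inclusion hA) := rfl

variable [TopologicalSpace Z]

/-- The metric piece `P` is an open subset of `Z` with a metric inducing the subspace topology. -/
def MetricPiece.IsCompatible (P : MetricPiece Z) : Prop :=
  IsOpen P.carrier ∧ P.topology = instTopologicalSpaceSubtype

theorem MetricPiece.IsCompatible.isOpenIn {P : MetricPiece Z} (hP : P.IsCompatible) {A : Set Z}
    (hA : IsOpen A) (hAP : A ⊆ P.carrier) : P.IsOpenIn A :=
  ⟨hAP, by rw [hP.2]; exact hA.preimage continuous_subtype_val⟩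

theorem MetricPiece.IsCompatible.isOpen {P : MetricPiece Z} (hP : P.IsCompatible) {A : Set Z}
    (hA : P.IsOpenIn A) : IsOpen A := by
  obtain ⟨h1, h2⟩ := hA
  rw [hP.2] at h2
  have := hP.1.isOpenMap_subtype_val _ h2
  rwa [Subtype.image_preimage_coe, inter_eq_right.2 h1] at this

theorem MetricPiece.IsCompatible.restrict_topology {P : MetricPiece Z} (hP : P.IsCompatible)
    (A : Set Z) (hA : A ⊆ P.carrier) :
    (P.restrict A hA).toPseudoMetricSpace.toUniformSpace.toTopologicalSpace =
      instTopologicalSpaceSubtype := by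
  rw [P.restrict_topology, hP.2]
  exact induced_compose

theorem isTopologicalBasis_balls {C : Set (MetricPiece Z)} (hC : ∀ P ∈ C, P.IsCompatible)
    (hcov : ∀ z : Z, ∃ P ∈ C, z ∈ P.carrier) : IsTopologicalBasis (balls C) := by
  refine isTopologicalBasis_of_isOpen_of_nhds ?_ ?_
  · rintro _ ⟨P, hP, x, r, -, rfl⟩
    refine (hC P hP).1.isOpenMap_subtype_val _ ?_
    rw [← (hC P hP).2]
    exact @Metric.isOpen_ball _ P.metric.toPseudoMetricSpace x r
  · intro a u ha hu
    obtain ⟨P, hP, haP⟩ := hcov a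
    have ho : IsOpen[P.topology] ((Subtype.val : P.carrier → Z) ⁻¹' u) := by
      rw [(hC P hP).2]; exact hu.preimage continuous_subtype_val
    obtain ⟨r, hr, h⟩ := (@Metric.isOpen_iff _ P.metric.toPseudoMetricSpace _).1 ho ⟨a, haP⟩ ha
    refine ⟨_, ⟨P, hP, ⟨a, haP⟩, r, hr, rfl⟩,
      ⟨⟨a, haP⟩, (P.dist_self' _).trans_lt hr, rfl⟩, ?_⟩
    rintro _ ⟨y, hy, rfl⟩
    exact h hy

/-- `InducesTopology` concerns every cover in the class, so compatibility must pass to equivalent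
covers. Near each point the topology of `P'` is determined by its overlap with a piece of `C`, where
the two metrics have the same topology. -/
theorem isCompatible_of_isLocalCover_union {C C' : Set (MetricPiece Z)}
    (hC : ∀ P ∈ C, P.IsCompatible) (hcov : ∀ z : Z, ∃ P ∈ C, z ∈ P.carrier)
    (h : IsLocalCover (C ∪ C')) {P' : MetricPiece Z} (hP' : P' ∈ C') : P'.IsCompatible := by
  have hopen : IsOpen P'.carrier := by
    rw [isOpen_iff_mem_nhds]
    intro y hy
    obtain ⟨P, hP, hyP⟩ := hcov y
    exact Filter.mem_of_superset (((hC P hP).isOpen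
      (h.1.2 P (Or.inl hP) P' (Or.inr hP')).1).mem_nhds ⟨hyP, hy⟩) inter_subset_right
  refine ⟨hopen, TopologicalSpace.ext_nhds fun y => ?_⟩
  obtain ⟨P, hP, hyP⟩ := hcov y
  have hloc := (h.2 P (Or.inl hP) P' (Or.inr hP')).1
  rw [(hC P hP).restrict_topology, P'.restrict_topology] at hloc
  have ho := (h.1.2 P (Or.inl hP) P' (Or.inr hP')).2.2
  rw [@isOpen_iff_mem_nhds _ P'.topology _] at ho
  have hr : range (inclusion (inter_subset_right : P.carrier ∩ P'.carrier ⊆ P'.carrier)) =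
      (Subtype.val : P'.carrier → Z) ⁻¹' (P.carrier ∩ P'.carrier) := by
    rw [range_inclusion]; rfl
  have h1 := @map_nhds_induced_of_mem _ _ P'.topology
    (inclusion (inter_subset_right : P.carrier ∩ P'.carrier ⊆ P'.carrier)) ⟨y, hyP, y.2⟩ (by
      rw [hr]
      exact ho _ ⟨hyP, y.2⟩)
  have h2 := @map_nhds_induced_of_mem _ _ instTopologicalSpaceSubtype
    (inclusion (inter_subset_right : P.carrier ∩ P'.carrier ⊆ P'.carrier)) ⟨y, hyP, y.2⟩ (by
      rw [hr]
      exact (((hC P hP).1.inter hopen).preimage continuous_subtype_val).mem_nhds ⟨hyP, y.2⟩)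
  have h3 : (instTopologicalSpaceSubtype : TopologicalSpace P'.carrier).induced
      (inclusion (inter_subset_right : P.carrier ∩ P'.carrier ⊆ P'.carrier)) =
      instTopologicalSpaceSubtype := induced_compose
  rw [← hloc] at h1
  rw [h3] at h2
  exact h1.symm.trans h2

variable {d : Z → Z → ℝ}

/-- The metric spaces given by restrictions of the function `d`. -/
def piecesOf (d : Z → Z → ℝ) : Set (MetricPiece Z) :=
  {P | P.IsCompatible ∧ ∀ x y : P.carrier, P.dist x y = d x y}

theorem IsCompatibleOn.exists_piece [T1Space Z] {V : Set Z} (hV : IsCompatibleOn d V) :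
    ∃ P ∈ piecesOf d, P.carrier = V := by
  let m : MetricSpace V := MetricSpace.ofDistTopology (fun x y => d x y)
    (fun x => hV.dist_self x x.2) (fun x y => hV.dist_comm x x.2 y y.2)
    (fun x y z => hV.dist_triangle x x.2 y y.2 z z.2) (fun s => by
      rw [isOpen_iff_mem_nhds]
      refine forall₂_congr fun x _ => ⟨fun hxs => ?_, ?_⟩
      · rw [nhds_subtype_eq_comap] at hxs
        obtain ⟨N, hN, hNs⟩ := hxs
        obtain ⟨ε, hε, h⟩ := hV.exists_lt x x.2 N hN
        exact ⟨ε, hε, fun y hy => hNs (h y y.2 hy)⟩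
      · rintro ⟨ε, hε, h⟩
        filter_upwards [continuous_subtype_val.continuousAt.eventually
          (hV.eventually_lt x x.2 ε hε)] with y hy using h y hy)
    (fun x y hxy => by
      by_contra hne
      have hne' : (x : Z) ≠ y := fun h => hne (Subtype.ext h)
      obtain ⟨ε, hε, h⟩ := hV.exists_lt x x.2 _ (compl_singleton_mem_nhds hne')
      exact h y y.2 (hxy.trans_lt hε) rfl)
  exact ⟨⟨V, m⟩, ⟨⟨hV.isOpen, rfl⟩, fun _ _ => rfl⟩, rfl⟩

theorem isLocalCover_piecesOf (hcov : ∀ z : Z, ∃ P ∈ piecesOf d, z ∈ P.carrier) :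
    IsLocalCover (piecesOf d) := by
  refine ⟨⟨hcov, fun P hP Q hQ => ?_⟩, fun P hP Q hQ => ⟨?_, fun z => ?_⟩⟩
  · exact ⟨hP.1.isOpenIn (hP.1.1.inter hQ.1.1) inter_subset_left,
      hQ.1.isOpenIn (hP.1.1.inter hQ.1.1) inter_subset_right⟩
  · rw [hP.1.restrict_topology, hQ.1.restrict_topology]
  · refine ⟨univ, @isOpen_univ _ (_), mem_univ _, fun x _ y _ => ?_⟩
    exact (hP.2 (inclusion inter_subset_left x) (inclusion inter_subset_left y)).trans
      (hQ.2 (inclusion inter_subset_right x) (inclusion inter_subset_right y)).symm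

/-- A function that is invariant under a pseudogroup and locally restricts to compatible metrics
defines a local metric for which the pseudogroup acts by local isometries. -/
theorem exists_isLocalMetric_of_invariant [T1Space Z] (H : StructureGroupoid Z)
    (hd : ∀ z : Z, ∃ V, z ∈ V ∧ IsCompatibleOn d V)
    (hinv : ∀ h ∈ H, ∀ z ∈ h.source, ∃ s, IsOpen s ∧ z ∈ s ∧
      ∀ x ∈ h.source ∩ s, ∀ y ∈ h.source ∩ s, d (h x) (h y) = d x y) :
    ∃ D : Set (Set (MetricPiece Z)), IsLocalMetric D ∧ InducesTopology D ∧
      ∀ h ∈ H, IsLocalIsometry D h := by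
  have hcov : ∀ z : Z, ∃ P ∈ piecesOf d, z ∈ P.carrier := fun z => by
    obtain ⟨V, hz, hV⟩ := hd z
    obtain ⟨P, hP, rfl⟩ := hV.exists_piece
    exact ⟨P, hP, hz⟩
  have hloc := isLocalCover_piecesOf hcov
  refine ⟨_, ⟨piecesOf d, hloc, rfl⟩, ?_, fun h hh => ⟨piecesOf d, ⟨hloc, ?_⟩, ?_⟩⟩
  · rintro C' ⟨hC', hun⟩
    exact isTopologicalBasis_balls
      (fun P' hP' => isCompatible_of_isLocalCover_union (fun P hP => hP.1) hcov hun hP') hC'.1.1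
  · rwa [union_self]
  · intro P hP R hR z hz hzP hzR
    obtain ⟨s, hs, hzs, hds⟩ := hinv h hh z hz
    refine ⟨(h.source ∩ h ⁻¹' R.carrier) ∩ (s ∩ P.carrier),
      ((h.isOpen_inter_preimage hR.1.1).inter (hs.inter hP.1.1)).mem_nhds ⟨⟨hz, hzR⟩, hzs, hzP⟩,
      fun x hx => hx.1.1, fun x hx => hx.2.2, fun x hx => hx.1.2, ?_⟩
    intro x hx y hy hxP hyP hxR hyR
    rw [hP.2, hR.2]
    exact (hds x ⟨hx.1.1, hx.2.1⟩ y ⟨hy.1.1, hy.2.1⟩).symm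

end LocalMetricOfDistance

/-! ### Proof of the theorem -/

theorem exists_restriction_of_mem_restrictions {Z : Type u} [TopologicalSpace Z]
    {H : StructureGroupoid Z} [ClosedUnderRestriction H] {S : Set (OpenPartialHomeomorph Z Z)}
    (hS : ∀ h ∈ S, h ∈ H) : ∀ h ∈ restrictions S, h ∈ H := by
  rintro h ⟨s, hs, h1, h2⟩
  have hsH : s ∈ H := by
    rcases hs with hs | rfl
    · exact hS s hs
    · exact H.id_mem
  refine H.mem_of_eqOnSource (closedUnderRestriction' hsH h.open_source) ⟨?_, fun x hx => h2 hx⟩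
  rw [OpenPartialHomeomorph.restr_source, h.open_source.interior_eq, inter_eq_right.2 h1]

end PseudoGrp

theorem theoremt {Z : Type u} [TopologicalSpace Z] [PolishSpace Z] [LocallyCompactSpace Z]
    (H : StructureGroupoid Z) [ClosedUnderRestriction H]
    (hcomp : PseudoGrp.IsCompactlyGenerated H)
    (hqe : PseudoGrp.IsQuasiEffective H)
    (hse : PseudoGrp.IsStronglyEquicontinuous H) :
    ∃ D : Set (Set (PseudoGrp.MetricPiece Z)),
      PseudoGrp.IsLocalMetric D ∧ PseudoGrp.InducesTopology D ∧
        ∀ h ∈ H, PseudoGrp.IsLocalIsometry D h := by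
  open PseudoGrp in
  let _ := metrizableSpaceMetric Z
  obtain ⟨U, hU, hmeet, E, hfin, hE, hgen, hext⟩ := hcomp
  obtain ⟨S₁, hS₁, hS₁', hgen₁, heff⟩ := hqe
  obtain ⟨_, ⟨C₀, -, rfl⟩, htop, C, hC, S₂, hS₂, hS₂', hgen₂, heq⟩ := hse
  have hT₁ := isRestrictionClosed_restrictions hS₁ hS₁'
  have hT₂ := isRestrictionClosed_restrictions hS₂ hS₂'
  -- The two hypotheses may come with different generating sets. Both properties pass to
  -- restrictions, so the intersection has both and still contains a restriction of each map of `H`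
  -- near each point.
  have hT := hT₁.inter hT₂
  have hTH : restrictions S₁ ∩ restrictions S₂ ⊆ {h | h ∈ H} := fun h hh =>
    exists_restriction_of_mem_restrictions (fun s hs => (hgen₁.1 hs).1) h hh.1
  have hHT : ∀ h ∈ H, ∀ x ∈ h.source, ∃ s, IsOpen s ∧ x ∈ s ∧
      h.restr s ∈ restrictions S₁ ∩ restrictions S₂ := by
    intro h hh x hx
    obtain ⟨s, hs, hxs, h1⟩ := hgen₁.exists_restr_mem hT₁ (subset_restrictions S₁) hh hx
    obtain ⟨t, ht, hxt, h2⟩ := hgen₂.exists_restr_mem hT₂ (subset_restrictions S₂) hh hx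
    refine ⟨s ∩ t, hs.inter ht, ⟨hxs, hxt⟩, hT₁.sub_mem _ h1 _ ?_ (fun _ _ => rfl),
      hT₂.sub_mem _ h2 _ ?_ (fun _ _ => rfl)⟩ <;>
    · simp only [OpenPartialHomeomorph.restr_source, interior_inter]
      intro y hy
      exact ⟨hy.1, by first | exact hy.2.1 | exact hy.2.2⟩
  have heffT : ∀ h ∈ restrictions S₁ ∩ restrictions S₂, ∀ x ∈ h.source, h =ᶠ[𝓝 x] id →
      EqOn h id h.source := by
    rintro h ⟨⟨s, hs, h1, h2⟩, -⟩ x hx hid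
    rcases hs with hs | rfl
    · obtain ⟨O, hO, hOo, hxO⟩ := mem_nhds_iff.1 (hid.and (h.open_source.mem_nhds hx))
      have := heff s hs ⟨O, hOo, ⟨x, hxO⟩, fun y hy => h1 (hO hy).2, fun y hy =>
        (h2 (hO hy).2).symm.trans (hO hy).1⟩
      exact fun y hy => (h2 hy).trans (this (h1 hy))
    · exact h2
  obtain ⟨r, hr, hequi⟩ := exists_equicontinuous hC.1 (htop C hC) heq hU
  obtain ⟨δ₀, hunif⟩ := exists_isUniformlyExtendable hT hTH hHT heffT hU hfin hE hgen hext hr (by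
    intro ε hε
    obtain ⟨δ, hδ, h⟩ := hequi ε hε
    exact ⟨δ, hδ, fun k hk x hx y hy hxU hkxU =>
      h k hk.2 x hx y hy (subset_closure hxU) (subset_closure hkxU)⟩)
  obtain ⟨d, hinv, hd⟩ := hunif.exists_invariant_dist U.isOpen
  refine exists_isLocalMetric_of_invariant (d := d) H (fun z => ?_) (fun h hh z hz => ?_)
  -- A map in `T` carries a neighborhood of `z` into `U` and preserves `d`, so the metric near `h z`
  -- pulls back to the same function near `z`.
  · obtain ⟨h, hh, hz, hhz⟩ := hmeet z
    obtain ⟨s, hs, hzs, hsT⟩ := hHT h hh z hz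
    obtain ⟨V, hzV, hV⟩ := hd (h z) hhz
    refine ⟨_, ?_, hV.preimage _ (hinv _ hsT)⟩
    rw [OpenPartialHomeomorph.restr_source, hs.interior_eq]
    exact ⟨⟨hz, hzs⟩, hzV⟩
  · obtain ⟨s, hs, hzs, hsT⟩ := hHT h hh z hz
    refine ⟨s, hs, hzs, ?_⟩
    have := hinv _ hsT
    rwa [OpenPartialHomeomorph.restr_source, hs.interior_eq] at this
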